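/- **Setting.** Let $M$ be a smooth (finite-dimensional, Hausdorff, $\sigma$-compact) manifold and $U\subseteq M$ an open set. Let $A$ be the algebra of smooth complex functions on $U$, $\Xi$ the Lie algebra of (complex) vector fields on $U$, i.e. derivations of $A$, and $\Omega^p$ the exterior $p$-forms on $U$. Let $g$ be a complex Lie algebra, $\rho:g\to\Xi$ a Lie algebra homomorphism (for example the restriction to $U$ of an action on $M$), and let $\mathcal F\in (Ug\otimes Ug)[[\lambda]]$ be a twist: $\mathcal F$ is invertible, $\mathcal F_{12}(\Delta\otimes \mathrm{id})\mathcal F=\mathcal F_{23}(\mathrm{id}\otimes\Delta)\mathcal F$, $(\varepsilon\otimes \mathrm{id})\mathcal F=1=(\mathrm{id}\otimes\varepsilon)\mathcal F$ and $\mathcal F=1\otimes1+O(\lambda)$. Write $\mathcal F^{-1}=\bar f^\alpha\otimes\bar f_\alpha$, $\mathcal R=\mathcal F_{21}\mathcal F^{-1}$ and $\mathcal R^{-1}=\bar R^\alpha\otimes\bar R_\alpha$. Via $\rho$, $Ug$ acts on functions, vector fields and forms by iterated Lie derivatives. Every bilinear map $\mu$ between these spaces is extended $\lambda$-bilinearly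 to formal power series in $\lambda$ and deformed to $\mu_\star(x,y)=\mu(\bar f^\alpha(x),\bar f_\alpha(y))$. This defines the products $h\star v$ and $\vartheta\star h$ of functions with vector fields and with forms, the $\star$-wedge product $\wedge_\star$, the pairing $\langle v,\theta\rangle_\star$ of vector fields with 1-forms, the $\star$-Lie derivative $\mathcal L^\star_u h$ and the bracket $[u,v]_\star$. The exterior derivative $d$ acts coefficientwise in $\lambda$. Repeated indices are summed. A $\star$-covariant derivative is a bilinear map $(u,v)\mapsto\nabla^\star_u v$ on $\Xi[[\lambda]]$ with $\nabla^\star_{h\star u}v=h\star\nabla^\star_u v$ and $\nabla^\star_u(h\star v)=\mathcal L^\star_u(h)\star v+\bar R^\alpha(h)\star\nabla^\star_{\bar R_\alpha(u)}v$ for all $h\in A[[\lambda]]$. Its torsion and curvature are $$\mathsf T(u,v)=\nabla^\star_uv-\nabla^\star_{\bar R^\alpha(v)}\bar R_\alpha(u)-[u,v]_\star,$$ $$\mathsf R(u,v,z)=\nabla^\star_u\nabla^\star_vz-\nabla^\star_{\bar R^\alpha(v)}\nabla^\star_{\bar R_\alpha(u)}z-\nabla^\star_{[u,v]_\star}z.$$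 Let $\{e_i\}$ be a finite frame of vector fields on $U$ ($e_i\in\Xi[[\lambda]]$, with $\lambda^0$-parts forming a basis of the $A$-module $\Xi$) and $\{\theta^j\}\subset\Omega^1[[\lambda]]$ the dual frame, $\langle e_i,\theta^j\rangle_\star=\delta_i^j$. Define $\Gamma_{ij}{}^k$ by $\nabla^\star_{e_i}e_j=\Gamma_{ij}{}^k\star e_k$ (that is, $\Gamma_{ij}{}^k=\langle\nabla^\star_{e_i}e_j,\theta^k\rangle_\star$), put $\mathsf T_{ij}{}^l=\langle \mathsf T(e_i,e_j),\theta^l\rangle_\star$ and $\mathsf R_{ijk}{}^l=\langle \mathsf R(e_i,e_j,e_k),\theta^l\rangle_\star$, and define the connection, $\star$-torsion and $\star$-curvature forms by $$\omega_i{}^j=\theta^k\star\Gamma_{ki}{}^j,\qquad \Theta^l=-\tfrac12\,\theta^j\wedge_\star\theta^i\star \mathsf T_{ij}{}^l,\qquad \Omega_k{}^l=-\tfrac12\,\theta^j\wedge_\star\theta^i\star \mathsf R_{ijk}{}^l .$$ **Bianchi identities.** For all $i,k,l$, $$d\Theta^i+\Theta^j\wedge_\star\omega_j{}^i=\theta^j\wedge_\star\Omega_j{}^i,$$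 $$d\Omega_k{}^l+\Omega_k{}^m\wedge_\star\omega_m{}^l-\omega_k{}^m\wedge_\star\Omega_m{}^l=0 .$$ -/

import Mathlib

open scoped TensorProduct Manifold ContDiff

noncomputable section

namespace StarGeometry

attribute [local instance 100] LieRing.ofAssociativeRing

/-! ### Cartan calculus on a commutative algebra of functions -/

section Cartan

variable (A : Type*) [CommRing A] [Algebra ℂ A]

/-- Vector fields: derivations of the algebra of functions, with the commutator as bracket. -/
abbrev Vec := Derivation ℂ A A

/-- 1-forms: function-linear maps on vector fields. -/
abbrev Form1 := Vec A →ₗ[A] A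

/-- The alternating function-bilinear maps on vector fields. -/
def form2Submodule : Submodule A (Vec A →ₗ[A] Vec A →ₗ[A] A) where
  carrier := {τ | ∀ u, τ u u = 0}
  add_mem' := by intro a b ha hb u; simp [ha u, hb u]
  zero_mem' := by intro u; simp
  smul_mem' := by intro c a ha u; simp [ha u]

/-- 2-forms: alternating function-multilinear maps on vector fields. -/
def Form2 : Type _ := ↥(form2Submodule A)

instance : AddCommGroup (Form2 A) :=
  @Submodule.addCommGroup A _ CommRing.toRing LinearMap.addCommGroup LinearMap.module
    (form2Submodule A)

instance : Module A (Form2 A) := Submodule.module (form2Submodule A)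

instance : Module ℂ (Form2 A) := Submodule.module' (form2Submodule A)

instance : IsScalarTower ℂ A (Form2 A) := Submodule.isScalarTower' (form2Submodule A)

variable {A}

@[simp] theorem Form2.add_apply (σ τ : Form2 A) (u v : Vec A) :
    (σ + τ).1 u v = σ.1 u v + τ.1 u v := rfl

@[simp] theorem Form2.sub_apply (σ τ : Form2 A) (u v : Vec A) :
    (σ - τ).1 u v = σ.1 u v - τ.1 u v := rfl

@[simp] theorem Form2.smul_apply (r : ℂ) (τ : Form2 A) (u v : Vec A) :
    (r • τ).1 u v = r • τ.1 u v := rfl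

theorem Form2.alt (τ : Form2 A) (u : Vec A) : τ.1 u u = 0 := τ.2 u

theorem Form2.swap (τ : Form2 A) (u v : Vec A) : τ.1 u v = -τ.1 v u := by
  have h := τ.2 (u + v)
  simp only [map_add, LinearMap.add_apply, τ.2 u, τ.2 v, zero_add, add_zero] at h
  exact eq_neg_of_add_eq_zero_right h

theorem vec_lie_smul (u v : Vec A) (f : A) : ⁅u, f • v⁆ = u f • v + f • ⁅u, v⁆ := by
  ext a
  simp only [Derivation.commutator_apply, Derivation.add_apply, Derivation.smul_apply,
    smul_eq_mul, Derivation.leibniz]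
  ring

theorem vec_smul_lie (u v : Vec A) (f : A) : ⁅f • u, v⁆ = f • ⁅u, v⁆ - v f • u := by
  rw [← lie_skew, vec_lie_smul, ← lie_skew v u]
  simp only [smul_neg]
  abel

/-- Assemble a 2-form from its values. -/
def Form2.mk (f : Vec A → Vec A → A)
    (a1 : ∀ u u' v, f (u + u') v = f u v + f u' v) (s1 : ∀ (c : A) u v, f (c • u) v = c * f u v)
    (a2 : ∀ u v v', f u (v + v') = f u v + f u v') (s2 : ∀ (c : A) u v, f u (c • v) = c * f u v)
    (alt : ∀ u, f u u = 0) : Form2 A :=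
  ⟨LinearMap.mk₂ A f a1 s1 a2 s2, alt⟩

@[simp] theorem Form2.mk_apply (f : Vec A → Vec A → A) (a1 s1 a2 s2 alt) (u v : Vec A) :
    (Form2.mk f a1 s1 a2 s2 alt).1 u v = f u v := rfl

theorem Form2.ext' {σ τ : Form2 A} (h : ∀ u v, σ.1 u v = τ.1 u v) : σ = τ :=
  Subtype.ext (LinearMap.ext₂ h)

variable (A)

/-- The function-linear maps `τ` from vector fields to 2-forms for which the function-trilinear
map `(u, v, w) ↦ τ(u)(v, w)` is alternating: being alternating in `v, w` is part of the notion of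
a 2-form, and what remains is `τ(u)(u, w) = 0`. -/
def form3Submodule : Submodule A (Vec A →ₗ[A] Form2 A) where
  carrier := {τ | ∀ u w, (τ u).1 u w = 0}
  add_mem' := by intro a b ha hb u w; simp [ha u w, hb u w]
  zero_mem' := by intro u w; rfl
  smul_mem' := by
    intro c a ha u w
    change c * (a u).1 u w = 0
    rw [ha u w, mul_zero]

/-- 3-forms: alternating function-trilinear maps on vector fields. -/
def Form3 : Type _ := ↥(form3Submodule A)

instance : AddCommGroup (Form3 A) :=
  @Submodule.addCommGroup A _ CommRing.toRing LinearMap.addCommGroup LinearMap.module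
    (form3Submodule A)

instance : Module A (Form3 A) := Submodule.module (form3Submodule A)

instance : Module ℂ (Form3 A) := Submodule.module' (form3Submodule A)

instance : IsScalarTower ℂ A (Form3 A) := Submodule.isScalarTower' (form3Submodule A)

variable {A}

/-- Assemble a 3-form from its values. -/
def Form3.mk (f : Vec A → Vec A → Vec A → A)
    (a1 : ∀ u u' v w, f (u + u') v w = f u v w + f u' v w)
    (s1 : ∀ (c : A) u v w, f (c • u) v w = c * f u v w)
    (a2 : ∀ u v v' w, f u (v + v') w = f u v w + f u v' w)
    (s2 : ∀ (c : A) u v w, f u (c • v) w = c * f u v w)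
    (a3 : ∀ u v w w', f u v (w + w') = f u v w + f u v w')
    (s3 : ∀ (c : A) u v w, f u v (c • w) = c * f u v w)
    (alt : ∀ u w, f u u w = 0) (alt' : ∀ u v, f u v v = 0) : Form3 A :=
  ⟨{ toFun := fun u => Form2.mk (f u) (a2 u) (fun c => s2 c u) (a3 u) (fun c => s3 c u) (alt' u)
     map_add' := fun u u' => Form2.ext' fun v w => a1 u u' v w
     map_smul' := fun c u => Form2.ext' fun v w => s1 c u v w }, alt⟩

/-- The value `τ(u, v, w)` of a 3-form. -/
def Form3.val (τ : Form3 A) (u v w : Vec A) : A := (τ.1 u).1 v w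

@[simp] theorem Form3.add_apply (σ τ : Form3 A) (u v w : Vec A) :
    (σ + τ).val u v w = σ.val u v w + τ.val u v w := rfl

@[simp] theorem Form3.sub_apply (σ τ : Form3 A) (u v w : Vec A) :
    (σ - τ).val u v w = σ.val u v w - τ.val u v w := rfl

@[simp] theorem Form3.smul_apply (r : ℂ) (τ : Form3 A) (u v w : Vec A) :
    (r • τ).val u v w = r • τ.val u v w := rfl

@[simp] theorem Form3.mk_apply (f : Vec A → Vec A → Vec A → A) (a1 s1 a2 s2 a3 s3 alt alt')
    (u v w : Vec A) : (Form3.mk f a1 s1 a2 s2 a3 s3 alt alt').val u v w = f u v w := rfl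

theorem Form3.ext' {σ τ : Form3 A} (h : ∀ u v w, σ.val u v w = τ.val u v w) : σ = τ :=
  Subtype.ext (LinearMap.ext fun u => Form2.ext' (h u))

/-- `(α ∧ β)(u, v) = α(u) β(v) - α(v) β(u)`. -/
def wedge11Val (α β : Form1 A) : Form2 A :=
  Form2.mk (fun u v => α u * β v - α v * β u)
    (by intros; simp only [map_add]; ring) (by intros; simp only [map_smul, smul_eq_mul]; ring)
    (by intros; simp only [map_add]; ring) (by intros; simp only [map_smul, smul_eq_mul]; ring)
    (by intros; ring)

/-- `(α ∧ τ)(u, v, w) = α(u) τ(v, w) - α(v) τ(u, w) + α(w) τ(u, v)`. -/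
def wedge12Val (α : Form1 A) (τ : Form2 A) : Form3 A :=
  Form3.mk (fun u v w => α u * τ.1 v w - α v * τ.1 u w + α w * τ.1 u v)
    (by intros; simp only [map_add, LinearMap.add_apply]; ring)
    (by intros; simp only [map_smul, LinearMap.smul_apply, smul_eq_mul]; ring)
    (by intros; simp only [map_add, LinearMap.add_apply]; ring)
    (by intros; simp only [map_smul, LinearMap.smul_apply, smul_eq_mul]; ring)
    (by intros; simp only [map_add]; ring)
    (by intros; simp only [map_smul, smul_eq_mul]; ring)
    (by intro u w; rw [Form2.alt τ]; ring)
    (by intro u v; rw [Form2.alt τ]; ring)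

/-- `(τ ∧ α)(u, v, w) = τ(u, v) α(w) - τ(u, w) α(v) + τ(v, w) α(u)`. -/
def wedge21Val (τ : Form2 A) (α : Form1 A) : Form3 A :=
  Form3.mk (fun u v w => τ.1 u v * α w - τ.1 u w * α v + τ.1 v w * α u)
    (by intros; simp only [map_add, LinearMap.add_apply]; ring)
    (by intros; simp only [map_smul, LinearMap.smul_apply, smul_eq_mul]; ring)
    (by intros; simp only [map_add, LinearMap.add_apply]; ring)
    (by intros; simp only [map_smul, LinearMap.smul_apply, smul_eq_mul]; ring)
    (by intros; simp only [map_add]; ring)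
    (by intros; simp only [map_smul, smul_eq_mul]; ring)
    (by intro u w; rw [Form2.alt τ]; ring)
    (by intro u v; rw [Form2.alt τ]; ring)

variable (A)

/-- The wedge product of 1-forms, as a bilinear map over `ℂ`. -/
def wedge11 : Form1 A →ₗ[ℂ] Form1 A →ₗ[ℂ] Form2 A :=
  LinearMap.mk₂ ℂ wedge11Val
    (fun a b c => Form2.ext' fun u v => by simp [wedge11Val]; ring)
    (fun r a b => Form2.ext' fun u v => by simp [wedge11Val, smul_sub])
    (fun a b c => Form2.ext' fun u v => by simp [wedge11Val]; ring)
    (fun r a b => Form2.ext' fun u v => by simp [wedge11Val, smul_sub])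

/-- The wedge product of a 1-form and a 2-form. -/
def wedge12 : Form1 A →ₗ[ℂ] Form2 A →ₗ[ℂ] Form3 A :=
  LinearMap.mk₂ ℂ wedge12Val
    (fun a b c => Form3.ext' fun u v w => by simp [wedge12Val]; ring)
    (fun r a b => Form3.ext' fun u v w => by simp [wedge12Val, smul_sub])
    (fun a b c => Form3.ext' fun u v w => by simp [wedge12Val]; ring)
    (fun r a b => Form3.ext' fun u v w => by simp [wedge12Val, smul_sub])

/-- The wedge product of a 2-form and a 1-form. -/
def wedge21 : Form2 A →ₗ[ℂ] Form1 A →ₗ[ℂ] Form3 A :=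
  LinearMap.mk₂ ℂ wedge21Val
    (fun a b c => Form3.ext' fun u v w => by simp [wedge21Val]; ring)
    (fun r a b => Form3.ext' fun u v w => by simp [wedge21Val, smul_sub])
    (fun a b c => Form3.ext' fun u v w => by simp [wedge21Val]; ring)
    (fun r a b => Form3.ext' fun u v w => by simp [wedge21Val, smul_sub])

/-- The exterior derivative of a 1-form: `dα(u, v) = u(α(v)) - v(α(u)) - α([u, v])`. -/
def d1 : Form1 A →ₗ[ℂ] Form2 A where
  toFun α := Form2.mk (fun u v => u (α v) - v (α u) - α ⁅u, v⁆)
    (by intros; simp only [map_add, Derivation.add_apply, add_lie]; ring)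
    (by
      intros
      simp only [vec_smul_lie, map_sub, map_smul, Derivation.smul_apply, smul_eq_mul,
        Derivation.leibniz]
      ring)
    (by intros; simp only [map_add, Derivation.add_apply, lie_add]; ring)
    (by
      intros
      simp only [vec_lie_smul, map_add, map_smul, Derivation.smul_apply, smul_eq_mul,
        Derivation.leibniz]
      ring)
    (by intros; simp)
  map_add' a b := Form2.ext' fun u v => by simp; ring
  map_smul' r a := Form2.ext' fun u v => by simp [smul_sub]

/-- The exterior derivative of a 2-form:
`dτ(u, v, w) = u τ(v, w) - v τ(u, w) + w τ(u, v) - τ([u, v], w) + τ([u, w], v) - τ([v, w], u)`. -/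
def d2 : Form2 A →ₗ[ℂ] Form3 A where
  toFun τ := Form3.mk (fun u v w => u (τ.1 v w) - v (τ.1 u w) + w (τ.1 u v)
      - τ.1 ⁅u, v⁆ w + τ.1 ⁅u, w⁆ v - τ.1 ⁅v, w⁆ u)
    (by intros; simp only [map_add, Derivation.add_apply, LinearMap.add_apply, add_lie]; ring)
    (by
      intro c u v w
      simp only [vec_smul_lie, map_sub, map_smul, Derivation.smul_apply, smul_eq_mul,
        Derivation.leibniz, LinearMap.smul_apply, LinearMap.sub_apply]
      ring)
    (by
      intros
      simp only [map_add, Derivation.add_apply, LinearMap.add_apply, lie_add, add_lie]; ring)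
    (by
      intro c u v w
      simp only [vec_smul_lie, vec_lie_smul, map_sub, map_add, map_smul, Derivation.smul_apply,
        smul_eq_mul, Derivation.leibniz, LinearMap.smul_apply, LinearMap.sub_apply,
        LinearMap.add_apply]
      rw [Form2.swap τ v u]
      ring)
    (by intros; simp only [map_add, Derivation.add_apply, LinearMap.add_apply, lie_add]; ring)
    (by
      intro c u v w
      simp only [vec_lie_smul, map_add, map_smul, Derivation.smul_apply,
        smul_eq_mul, Derivation.leibniz, LinearMap.smul_apply, LinearMap.add_apply]
      rw [Form2.swap τ w v, Form2.swap τ w u]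
      ring)
    (by intro u w; simp [Form2.alt τ])
    (by intro u v; simp [Form2.alt τ])
  map_add' a b := Form3.ext' fun u v w => by simp; ring
  map_smul' r a := Form3.ext' fun u v w => by simp [smul_sub, smul_add]

/-- The Lie derivative of functions, `ℒ_u f = u(f)`. -/
def lieFun : Vec A →ₗ⁅ℂ⁆ Module.End ℂ A := LieModule.toEnd ℂ (Vec A) A

/-- The Lie derivative of vector fields, `ℒ_u v = [u, v]`. -/
def lieVec : Vec A →ₗ⁅ℂ⁆ Module.End ℂ (Vec A) := LieModule.toEnd ℂ (Vec A) (Vec A)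

variable {A}

/-- `(ℒ_u α)(v) = u(α(v)) - α([u, v])`. -/
def lieForm1Val (u : Vec A) (α : Form1 A) : Form1 A where
  toFun v := u (α v) - α ⁅u, v⁆
  map_add' _ _ := by simp only [map_add, lie_add]; ring
  map_smul' _ _ := by
    simp only [map_smul, map_add, vec_lie_smul, smul_eq_mul, Derivation.leibniz, RingHom.id_apply]
    ring

/-- `(ℒ_u τ)(v, w) = u(τ(v, w)) - τ([u, v], w) - τ(v, [u, w])`. -/
def lieForm2Val (u : Vec A) (τ : Form2 A) : Form2 A :=
  Form2.mk (fun v w => u (τ.1 v w) - τ.1 ⁅u, v⁆ w - τ.1 v ⁅u, w⁆)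
    (by intros; simp only [map_add, LinearMap.add_apply, lie_add]; ring)
    (by
      intros
      simp only [map_smul, map_add, vec_lie_smul, smul_eq_mul, Derivation.leibniz,
        LinearMap.add_apply, LinearMap.smul_apply]
      ring)
    (by intros; simp only [map_add, lie_add]; ring)
    (by
      intros
      simp only [map_smul, map_add, vec_lie_smul, smul_eq_mul, Derivation.leibniz]
      ring)
    (by intro v; rw [Form2.alt τ, Form2.swap τ v ⁅u, v⁆]; simp)

variable (A)

/-- The Lie derivative of 1-forms. -/
def lieForm1 : Vec A →ₗ⁅ℂ⁆ Module.End ℂ (Form1 A) where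
  toFun u :=
    { toFun := lieForm1Val u
      map_add' := fun a b => by ext v; simp [lieForm1Val]; ring
      map_smul' := fun r a => by ext v; simp [lieForm1Val, smul_sub] }
  map_add' u v := by ext a w; simp [lieForm1Val]; ring
  map_smul' r u := by ext a w; simp [lieForm1Val, smul_sub]
  map_lie' {u v} := by
    ext a w
    simp only [lieForm1Val, LinearMap.coe_mk, AddHom.coe_mk, Derivation.commutator_apply,
      Ring.lie_def, LinearMap.sub_apply, Module.End.mul_apply, map_sub, lie_lie]
    ring

/-- The Lie derivative of 2-forms. -/
def lieForm2 : Vec A →ₗ⁅ℂ⁆ Module.End ℂ (Form2 A) where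
  toFun u :=
    { toFun := lieForm2Val u
      map_add' := fun a b => Form2.ext' fun v w => by simp [lieForm2Val]; ring
      map_smul' := fun r a => Form2.ext' fun v w => by simp [lieForm2Val, smul_sub] }
  map_add' u v := LinearMap.ext fun τ => Form2.ext' fun x y => by simp [lieForm2Val]; ring
  map_smul' r u := LinearMap.ext fun τ => Form2.ext' fun x y => by simp [lieForm2Val, smul_sub]
  map_lie' {u v} := LinearMap.ext fun τ => Form2.ext' fun x y => by
    simp only [lieForm2Val, LinearMap.coe_mk, AddHom.coe_mk, Derivation.commutator_apply,
      Ring.lie_def, LinearMap.sub_apply, Module.End.mul_apply, map_sub, lie_lie, Form2.mk_apply,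
      Form2.sub_apply]
    ring

/-- The product of two functions. -/
def mulFun : A →ₗ[ℂ] A →ₗ[ℂ] A := LinearMap.mul ℂ A

/-- The product `h v` of a function and a vector field. -/
def mulVec : A →ₗ[ℂ] Vec A →ₗ[ℂ] Vec A := (Algebra.lsmul ℂ ℂ (Vec A)).toLinearMap

/-- The product `α h` of a 1-form and a function. -/
def mulForm1 : Form1 A →ₗ[ℂ] A →ₗ[ℂ] Form1 A :=
  ((Algebra.lsmul ℂ ℂ (Form1 A)).toLinearMap).flip

/-- The product `τ h` of a 2-form and a function. -/
def mulForm2 : Form2 A →ₗ[ℂ] A →ₗ[ℂ] Form2 A :=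
  ((Algebra.lsmul ℂ ℂ (Form2 A)).toLinearMap).flip

/-- The pairing `⟨v, α⟩` of a vector field and a 1-form. -/
def pairing : Vec A →ₗ[ℂ] Form1 A →ₗ[ℂ] A :=
  LinearMap.mk₂ ℂ (fun v α => α v) (by simp) (by simp) (by simp) (by simp)

end Cartan

/-! ### Twists -/

section Twist

variable (g : Type*) [LieRing g] [LieAlgebra ℂ g]

/-- The universal enveloping algebra `Ug`. -/
abbrev Env := UniversalEnvelopingAlgebra ℂ g

/-- The coproduct of `Ug`: the algebra map with `t ↦ t ⊗ 1 + 1 ⊗ t` for `t ∈ g`. -/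
def coproduct : Env g →ₐ[ℂ] Env g ⊗[ℂ] Env g :=
  UniversalEnvelopingAlgebra.lift ℂ
    { toFun := fun t => UniversalEnvelopingAlgebra.ι ℂ t ⊗ₜ[ℂ] 1
        + 1 ⊗ₜ[ℂ] UniversalEnvelopingAlgebra.ι ℂ t
      map_add' := fun s t => by
        simp only [map_add, TensorProduct.add_tmul, TensorProduct.tmul_add]; abel
      map_smul' := fun r t => by
        simp [TensorProduct.smul_tmul', TensorProduct.tmul_smul]
      map_lie' := by
        intro s t
        simp only [LieHom.map_lie, Ring.lie_def, mul_add, add_mul,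
          Algebra.TensorProduct.tmul_mul_tmul, one_mul, mul_one, TensorProduct.sub_tmul,
          TensorProduct.tmul_sub]
        abel }

/-- The counit of `Ug`: the algebra map with `t ↦ 0` for `t ∈ g`. -/
def counit : Env g →ₐ[ℂ] ℂ := UniversalEnvelopingAlgebra.lift ℂ 0

/-- A twist: an invertible `ℱ ∈ (Ug ⊗ Ug)[[λ]]` satisfying the 2-cocycle condition
`ℱ₁₂ (Δ ⊗ id) ℱ = ℱ₂₃ (id ⊗ Δ) ℱ`, the normalization `(ε ⊗ id) ℱ = 1 = (id ⊗ ε) ℱ`,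
and `ℱ = 1 ⊗ 1 + O(λ)`. -/
structure Twist where
  F : (PowerSeries (Env g ⊗[ℂ] Env g))ˣ
  cocycle :
    PowerSeries.map ((Algebra.TensorProduct.assoc ℂ ℂ ℂ (Env g) (Env g) (Env g)).toAlgHom.comp
        Algebra.TensorProduct.includeLeft).toRingHom F.val
      * PowerSeries.map ((Algebra.TensorProduct.assoc ℂ ℂ ℂ (Env g) (Env g) (Env g)).toAlgHom.comp
        (Algebra.TensorProduct.map (coproduct g) (AlgHom.id ℂ (Env g)))).toRingHom F.val
    = PowerSeries.map (Algebra.TensorProduct.includeRight :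
        Env g ⊗[ℂ] Env g →ₐ[ℂ] Env g ⊗[ℂ] (Env g ⊗[ℂ] Env g)).toRingHom F.val
      * PowerSeries.map
        (Algebra.TensorProduct.map (AlgHom.id ℂ (Env g)) (coproduct g)).toRingHom F.val
  counit_left :
    PowerSeries.map ((Algebra.TensorProduct.lid ℂ (Env g)).toAlgHom.comp
      (Algebra.TensorProduct.map (counit g) (AlgHom.id ℂ (Env g)))).toRingHom F.val = 1
  counit_right :
    PowerSeries.map ((Algebra.TensorProduct.rid ℂ ℂ (Env g)).toAlgHom.comp
      (Algebra.TensorProduct.map (AlgHom.id ℂ (Env g)) (counit g))).toRingHom F.val = 1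
  leading : PowerSeries.constantCoeff F.val = 1

variable {g}

/-- `ℱ₂₁`, the twist with its two tensor factors exchanged. -/
def Twist.F21 (T : Twist g) : (PowerSeries (Env g ⊗[ℂ] Env g))ˣ :=
  Units.map (PowerSeries.map
    (Algebra.TensorProduct.comm ℂ (Env g) (Env g)).toAlgHom.toRingHom).toMonoidHom T.F

/-- The universal R-matrix `ℛ = ℱ₂₁ ℱ⁻¹`. -/
def Twist.R (T : Twist g) : (PowerSeries (Env g ⊗[ℂ] Env g))ˣ := T.F21 * T.F⁻¹

/-- `X[[λ]]`: the formal power series `∑ λⁿ xₙ` with coefficients in `X`, as the sequence of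
their coefficients. -/
abbrev Formal (X : Type*) := ℕ → X

/-- The extension of a linear map to formal power series, coefficient by coefficient. -/
def formalMap {X Y : Type*} [AddCommGroup X] [Module ℂ X] [AddCommGroup Y] [Module ℂ Y]
    (f : X →ₗ[ℂ] Y) : Formal X →ₗ[ℂ] Formal Y where
  toFun x n := f (x n)
  map_add' x y := by funext n; simp
  map_smul' r x := by funext n; simp

section Bilinear

variable {X Y Z : Type*} [AddCommGroup X] [Module ℂ X] [AddCommGroup Y] [Module ℂ Y]
  [AddCommGroup Z] [Module ℂ Z]

/-- The `λ`-bilinear extension of a bilinear map to formal power series. -/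
def formalBilin (μ : X →ₗ[ℂ] Y →ₗ[ℂ] Z) : Formal X →ₗ[ℂ] Formal Y →ₗ[ℂ] Formal Z :=
  LinearMap.mk₂ ℂ (fun x y n => ∑ p ∈ Finset.HasAntidiagonal.antidiagonal n, μ (x p.1) (y p.2))
    (fun x x' y => by funext n; simp [Finset.sum_add_distrib])
    (fun r x y => by funext n; simp [Finset.smul_sum])
    (fun x y y' => by funext n; simp [Finset.sum_add_distrib])
    (fun r x y => by funext n; simp [Finset.smul_sum])

/-- For actions `a`, `b` of `Ug` on `X`, `Y` and a bilinear map `B` on formal power series: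
the bilinear map on `Ug × Ug` given by `(ξ, η) ↦ B(ξ(x), η(y))`. -/
def actPair (a : Env g →ₐ[ℂ] Module.End ℂ X) (b : Env g →ₐ[ℂ] Module.End ℂ Y)
    (B : Formal X →ₗ[ℂ] Formal Y →ₗ[ℂ] Formal Z) (x : Formal X) (y : Formal Y) :
    Env g →ₗ[ℂ] Env g →ₗ[ℂ] Formal Z :=
  LinearMap.mk₂ ℂ (fun ξ η => B (formalMap (a ξ) x) (formalMap (b η) y))
    (fun ξ ξ' η => by
      have : formalMap (a (ξ + ξ')) x = formalMap (a ξ) x + formalMap (a ξ') x := by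
        funext n; simp [formalMap]
      rw [this]; simp)
    (fun r ξ η => by
      have : formalMap (a (r • ξ)) x = r • formalMap (a ξ) x := by
        funext n; simp [formalMap]
      rw [this]; simp)
    (fun ξ η η' => by
      have : formalMap (b (η + η')) y = formalMap (b η) y + formalMap (b η') y := by
        funext n; simp [formalMap]
      rw [this]; simp)
    (fun r ξ η => by
      have : formalMap (b (r • η)) y = r • formalMap (b η) y := by
        funext n; simp [formalMap]
      rw [this]; simp)

/-- Composition `B ∘ 𝒯` of a bilinear map `B` with the action of
`𝒯 = ∑ₖ λᵏ 𝒯ₖ ∈ (Ug ⊗ Ug)[[λ]]`, that is, writing `𝒯 = t^α ⊗ t_α`,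
`(x, y) ↦ B(t^α(x), t_α(y)) = ∑ₖ λᵏ B(𝒯ₖ(x ⊗ y))`. -/
def twistBy (T : PowerSeries (Env g ⊗[ℂ] Env g)) (a : Env g →ₐ[ℂ] Module.End ℂ X)
    (b : Env g →ₐ[ℂ] Module.End ℂ Y) (B : Formal X →ₗ[ℂ] Formal Y →ₗ[ℂ] Formal Z) :
    Formal X →ₗ[ℂ] Formal Y →ₗ[ℂ] Formal Z :=
  LinearMap.mk₂ ℂ
    (fun x y n => ∑ p ∈ Finset.HasAntidiagonal.antidiagonal n,
      TensorProduct.lift (actPair a b B x y) (PowerSeries.coeff p.1 T) p.2)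
    (fun x x' y => by
      have : actPair a b B (x + x') y = actPair a b B x y + actPair a b B x' y := by
        ext ξ η : 2; simp [actPair]
      have h : TensorProduct.lift (actPair a b B (x + x') y)
          = TensorProduct.lift (actPair a b B x y) + TensorProduct.lift (actPair a b B x' y) := by
        rw [this]; ext; simp
      funext n; simp [h, Finset.sum_add_distrib])
    (fun r x y => by
      have : actPair a b B (r • x) y = r • actPair a b B x y := by
        ext ξ η : 2; simp [actPair]
      have h : TensorProduct.lift (actPair a b B (r • x) y)
          = r • TensorProduct.lift (actPair a b B x y) := by
        rw [this]; ext; simp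
      funext n; simp [h, Finset.smul_sum])
    (fun x y y' => by
      have : actPair a b B x (y + y') = actPair a b B x y + actPair a b B x y' := by
        ext ξ η : 2; simp [actPair]
      have h : TensorProduct.lift (actPair a b B x (y + y'))
          = TensorProduct.lift (actPair a b B x y) + TensorProduct.lift (actPair a b B x y') := by
        rw [this]; ext; simp
      funext n; simp [h, Finset.sum_add_distrib])
    (fun r x y => by
      have : actPair a b B x (r • y) = r • actPair a b B x y := by
        ext ξ η : 2; simp [actPair]
      have h : TensorProduct.lift (actPair a b B x (r • y))
          = r • TensorProduct.lift (actPair a b B x y) := by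
        rw [this]; ext; simp
      funext n; simp [h, Finset.smul_sum])

/-- The deformation `μ_⋆ = μ ∘ ℱ⁻¹` of a bilinear map `μ`. -/
def starOf (T : Twist g) (a : Env g →ₐ[ℂ] Module.End ℂ X) (b : Env g →ₐ[ℂ] Module.End ℂ Y)
    (μ : X →ₗ[ℂ] Y →ₗ[ℂ] Z) : Formal X →ₗ[ℂ] Formal Y →ₗ[ℂ] Formal Z :=
  twistBy (T.F⁻¹).val a b (formalBilin μ)

end Bilinear

end Twist

/-! ### The ⋆-geometry of a Lie algebra `g` with twist, acting by vector fields -/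

section Star

variable {A : Type*} [CommRing A] [Algebra ℂ A] {g : Type*} [LieRing g] [LieAlgebra ℂ g]
  (T : Twist g) (ρ : g →ₗ⁅ℂ⁆ Vec A)

/-- The action of `Ug` on functions by iterated Lie derivatives. -/
def actFun : Env g →ₐ[ℂ] Module.End ℂ A :=
  UniversalEnvelopingAlgebra.lift ℂ ((lieFun A).comp ρ)

/-- The action of `Ug` on vector fields by iterated Lie derivatives. -/
def actVec : Env g →ₐ[ℂ] Module.End ℂ (Vec A) :=
  UniversalEnvelopingAlgebra.lift ℂ ((lieVec A).comp ρ)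

/-- The action of `Ug` on 1-forms by iterated Lie derivatives. -/
def actForm1 : Env g →ₐ[ℂ] Module.End ℂ (Form1 A) :=
  UniversalEnvelopingAlgebra.lift ℂ ((lieForm1 A).comp ρ)

/-- The action of `Ug` on 2-forms by iterated Lie derivatives. -/
def actForm2 : Env g →ₐ[ℂ] Module.End ℂ (Form2 A) :=
  UniversalEnvelopingAlgebra.lift ℂ ((lieForm2 A).comp ρ)

/-- `h ⋆ v` for a function `h` and a vector field `v`. -/
def starVec : Formal A →ₗ[ℂ] Formal (Vec A) →ₗ[ℂ] Formal (Vec A) :=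
  starOf T (actFun ρ) (actVec ρ) (mulVec A)

/-- `α ⋆ h` for a 1-form `α` and a function `h`. -/
def starForm1 : Formal (Form1 A) →ₗ[ℂ] Formal A →ₗ[ℂ] Formal (Form1 A) :=
  starOf T (actForm1 ρ) (actFun ρ) (mulForm1 A)

/-- `τ ⋆ h` for a 2-form `τ` and a function `h`. -/
def starForm2 : Formal (Form2 A) →ₗ[ℂ] Formal A →ₗ[ℂ] Formal (Form2 A) :=
  starOf T (actForm2 ρ) (actFun ρ) (mulForm2 A)

/-- `α ∧_⋆ β` for 1-forms. -/
def starWedge11 : Formal (Form1 A) →ₗ[ℂ] Formal (Form1 A) →ₗ[ℂ] Formal (Form2 A) :=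
  starOf T (actForm1 ρ) (actForm1 ρ) (wedge11 A)

/-- `α ∧_⋆ τ` for a 1-form `α` and a 2-form `τ`. -/
def starWedge12 : Formal (Form1 A) →ₗ[ℂ] Formal (Form2 A) →ₗ[ℂ] Formal (Form3 A) :=
  starOf T (actForm1 ρ) (actForm2 ρ) (wedge12 A)

/-- `τ ∧_⋆ α` for a 2-form `τ` and a 1-form `α`. -/
def starWedge21 : Formal (Form2 A) →ₗ[ℂ] Formal (Form1 A) →ₗ[ℂ] Formal (Form3 A) :=
  starOf T (actForm2 ρ) (actForm1 ρ) (wedge21 A)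

/-- The ⋆-pairing `⟨v, α⟩_⋆` of a vector field and a 1-form. -/
def starPairing : Formal (Vec A) →ₗ[ℂ] Formal (Form1 A) →ₗ[ℂ] Formal A :=
  starOf T (actVec ρ) (actForm1 ρ) (pairing A)

/-- The ⋆-Lie derivative `ℒ^⋆_u(h)` of a function `h`. -/
def starLieFun : Formal (Vec A) →ₗ[ℂ] Formal A →ₗ[ℂ] Formal A :=
  starOf T (actVec ρ) (actFun ρ) (lieFun A : Vec A →ₗ[ℂ] A →ₗ[ℂ] A)

/-- The ⋆-Lie bracket `[u, v]_⋆`. -/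
def starLie : Formal (Vec A) →ₗ[ℂ] Formal (Vec A) →ₗ[ℂ] Formal (Vec A) :=
  starOf T (actVec ρ) (actVec ρ) (lieVec A : Vec A →ₗ[ℂ] Vec A →ₗ[ℂ] Vec A)

/-- A ⋆-covariant derivative `u, z ↦ ∇^⋆_u z`: it is additive in `u` and `z`, and
`∇^⋆_{h ⋆ u} v = h ⋆ ∇^⋆_u v`,
`∇^⋆_u (h ⋆ v) = ℒ^⋆_u(h) ⋆ v + R̄^α(h) ⋆ ∇^⋆_{R̄_α(u)} v`, where `ℛ⁻¹ = R̄^α ⊗ R̄_α`.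
(Linearity over `ℂ[[λ]]` follows by taking `h` constant on the manifold.) -/
structure StarConnection where
  nabla : Formal (Vec A) →ₗ[ℂ] Formal (Vec A) →ₗ[ℂ] Formal (Vec A)
  nabla_star_left : ∀ (h : Formal A) (u v : Formal (Vec A)),
    nabla (starVec T ρ h u) v = starVec T ρ h (nabla u v)
  nabla_star_right : ∀ (u : Formal (Vec A)) (h : Formal A) (v : Formal (Vec A)),
    nabla u (starVec T ρ h v) = starVec T ρ (starLieFun T ρ u h) v
      + twistBy (T.R⁻¹).val (actFun ρ) (actVec ρ) ((starVec T ρ).compl₂ (nabla.flip v)) h u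

variable {T ρ}

/-- The torsion `T(u, v) = ∇^⋆_u v - ∇^⋆_{R̄^α(v)} R̄_α(u) - [u, v]_⋆`. -/
def StarConnection.torsion (D : StarConnection T ρ) (u v : Formal (Vec A)) : Formal (Vec A) :=
  D.nabla u v - twistBy (T.R⁻¹).val (actVec ρ) (actVec ρ) D.nabla v u - starLie T ρ u v

/-- The bilinear map `(u, v) ↦ ∇^⋆_u ∇^⋆_v z`. -/
def StarConnection.nabla₂ (D : StarConnection T ρ) (z : Formal (Vec A)) :
    Formal (Vec A) →ₗ[ℂ] Formal (Vec A) →ₗ[ℂ] Formal (Vec A) :=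
  D.nabla.compl₂ (D.nabla.flip z)

/-- The curvature
`R(u, v, z) = ∇^⋆_u ∇^⋆_v z - ∇^⋆_{R̄^α(v)} ∇^⋆_{R̄_α(u)} z - ∇^⋆_{[u, v]_⋆} z`. -/
def StarConnection.curvature (D : StarConnection T ρ) (u v z : Formal (Vec A)) :
    Formal (Vec A) :=
  D.nabla₂ z u v - twistBy (T.R⁻¹).val (actVec ρ) (actVec ρ) (D.nabla₂ z) v u
    - D.nabla (starLie T ρ u v) z

variable (T ρ)

/-- A frame of vector fields together with its ⋆-dual frame of 1-forms: the classical
(`λ⁰`) parts of the `eᵢ` form a basis of the module of vector fields over the functions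
(equivalently, the `eᵢ` form a basis of the left `A_⋆`-module of vector fields), and
`⟨eᵢ, θʲ⟩_⋆ = δᵢʲ`. -/
structure StarFrame (ι : Type*) [DecidableEq ι] where
  e : ι → Formal (Vec A)
  θ : ι → Formal (Form1 A)
  linearIndependent : LinearIndependent A fun i => e i 0
  span_eq_top : Submodule.span A (Set.range fun i => e i 0) = ⊤
  dual : ∀ i j, starPairing T ρ (e i) (θ j) = if i = j then Pi.single 0 1 else 0

variable {T ρ}

section Frame

variable {ι : Type*} [Fintype ι] [DecidableEq ι] (D : StarConnection T ρ) (E : StarFrame T ρ ι)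

/-- The connection coefficients `Γᵢⱼᵏ = ⟨∇^⋆_{eᵢ} eⱼ, θᵏ⟩_⋆`, that is,
`∇^⋆_{eᵢ} eⱼ = Γᵢⱼᵏ ⋆ eₖ`. -/
def christoffel (i j k : ι) : Formal A := starPairing T ρ (D.nabla (E.e i) (E.e j)) (E.θ k)

/-- The coefficients `Tᵢⱼˡ = ⟨T(eᵢ, eⱼ), θˡ⟩_⋆` of the torsion. -/
def torsionCoeff (i j l : ι) : Formal A :=
  starPairing T ρ (D.torsion (E.e i) (E.e j)) (E.θ l)

/-- The coefficients `Rᵢⱼₖˡ = ⟨R(eᵢ, eⱼ, eₖ), θˡ⟩_⋆` of the curvature. -/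
def curvatureCoeff (i j k l : ι) : Formal A :=
  starPairing T ρ (D.curvature (E.e i) (E.e j) (E.e k)) (E.θ l)

/-- The connection forms `ωᵢʲ = θᵏ ⋆ Γₖᵢʲ`. -/
def connectionForm (i j : ι) : Formal (Form1 A) :=
  ∑ k, starForm1 T ρ (E.θ k) (christoffel D E k i j)

/-- The torsion forms `Θˡ = -½ θʲ ∧_⋆ θⁱ ⋆ Tᵢⱼˡ`. -/
def torsionForm (l : ι) : Formal (Form2 A) :=
  -((1 / 2 : ℂ) • ∑ i, ∑ j,
    starForm2 T ρ (starWedge11 T ρ (E.θ j) (E.θ i)) (torsionCoeff D E i j l))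

/-- The curvature forms `Ωₖˡ = -½ θʲ ∧_⋆ θⁱ ⋆ Rᵢⱼₖˡ`. -/
def curvatureForm (k l : ι) : Formal (Form2 A) :=
  -((1 / 2 : ℂ) • ∑ i, ∑ j,
    starForm2 T ρ (starWedge11 T ρ (E.θ j) (E.θ i)) (curvatureCoeff D E i j k l))

end Frame

end Star

/-! ### Manifolds -/

/-- The algebra of smooth complex-valued functions on a manifold modelled on `E`. -/
def SmoothFun (E : Type*) [NormedAddCommGroup E] [NormedSpace ℝ E] (M : Type*)
    [TopologicalSpace M] [ChartedSpace E M] : Subalgebra ℂ (M → ℂ) where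
  carrier := {f | ContMDiff 𝓘(ℝ, E) 𝓘(ℝ, ℂ) ∞ f}
  mul_mem' := by
    intro f h hf hh
    exact ContDiff.comp_contMDiff (g := fun p : ℂ × ℂ => p.1 * p.2) contDiff_mul
      (hf.prodMk_space hh)
  add_mem' := by intro f h hf hh; exact ContMDiff.add hf hh
  algebraMap_mem' := by intro r; exact contMDiff_const

end StarGeometry

end

/-!
The twist `ℱ` turns every classical operation `μ` that commutes with Lie derivatives into
`μ_⋆ = μ ∘ ℱ⁻¹`, and two facts transport classical identities to the deformed calculus.

* By the cocycle condition, `μ_⋆(ν_⋆(x, y), z)` and `μ_⋆(x, ν_⋆(y, z))` are the classical trilinear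
  maps `μ(ν(x, y), z)` and `μ(x, ν(y, z))` composed with one and the same operator `Φ`
  (`starOf_starOf_left`, `starOf_starOf_right`); hence associativity laws survive (`starOf_assoc`).
* As the coproduct of `Ug` is cocommutative, exchanging the first two arguments by `ℛ⁻¹` amounts to
  the classical exchange in the trilinear map that precedes `Φ` (`twistBy_R_inv`).

So the product `∧_⋆` is associative, the classical `d` is a graded derivation of it
(`d2_starWedge11`), and the formula for `dη(u, v)` and the wedge product of 1-forms have deformed
versions in which `u` and `v` are exchanged by `ℛ⁻¹` (`starCartan`, `nestedPairing_sub_swap`).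

The connection itself is not equivariant, but in a frame it is encoded by the forms `ωᵢʲ`, on which
only equivariant operations act. The dual frames resolve the identity, `∑ θʲ ⊗_⋆ eⱼ = id`
(`StarFrame.sum_rankOne`). This gives the expansions of vector fields, of 1-forms and of 2-forms,
and `⟨∇^⋆_u eₖ, θˡ⟩_⋆ = ⟨u, ωₖˡ⟩_⋆`. Torsion and curvature are both antisymmetrizations of
`∇^⋆_u (⟨v, ηᵐ⟩_⋆ ⋆ eₘ)`, for `ηᵐ = θᵐ` and `ηᵐ = ωₖᵐ`; computing that expression
(`starPairing_antisymm_nabla`) yields the Cartan structure equations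
`Θˡ = dθˡ - θᵐ ∧_⋆ ωₘˡ` and `Ωₖˡ = dωₖˡ - ωₖᵐ ∧_⋆ ωₘˡ` (`torsionForm_eq`, `curvatureForm_eq`).
The Bianchi identities are what `d² = 0`, the Leibniz rule and associativity say about these
(`covariant_d2`). The argument works over any commutative algebra of functions.
-/

open scoped TensorProduct Manifold ContDiff

noncomputable section

namespace StarGeometry

attribute [local instance 100] LieRing.ofAssociativeRing

open Finset.HasAntidiagonal (antidiagonal)

/-! ### Power series of operators acting on formal power series -/

section PowerSeriesAction

variable {S S' V W X Y Z : Type*} [Ring S] [Algebra ℂ S] [Ring S'] [Algebra ℂ S']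
  [AddCommGroup V] [Module ℂ V] [AddCommGroup W] [Module ℂ W]
  [AddCommGroup X] [Module ℂ X] [AddCommGroup Y] [Module ℂ Y] [AddCommGroup Z] [Module ℂ Z]

theorem sum_antidiagonal_assoc {M : Type*} [AddCommMonoid M] (f : ℕ → ℕ → ℕ → M) (n : ℕ) :
    ∑ p ∈ antidiagonal n, ∑ q ∈ antidiagonal p.1, f q.1 q.2 p.2
      = ∑ p ∈ antidiagonal n, ∑ q ∈ antidiagonal p.2, f p.1 q.1 q.2 := by
  simp only [Finset.sum_sigma']
  apply Finset.sum_nbij' (fun ⟨⟨_i, j⟩, ⟨k, l⟩⟩ ↦ ⟨(k, l + j), (l, j)⟩)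
    (fun ⟨⟨i, _j⟩, ⟨k, l⟩⟩ ↦ ⟨(i + k, l), (i, k)⟩) <;>
    rintro ⟨⟨i, j⟩, ⟨k, l⟩⟩ h <;>
    simp only [Finset.mem_sigma, Finset.HasAntidiagonal.mem_antidiagonal] at h ⊢ <;>
    obtain ⟨rfl, rfl⟩ := h <;> simp [add_assoc]

theorem sum_antidiagonal_left_comm {M : Type*} [AddCommMonoid M] (f : ℕ → ℕ → ℕ → M) (n : ℕ) :
    ∑ p ∈ antidiagonal n, ∑ q ∈ antidiagonal p.2, f p.1 q.1 q.2
      = ∑ p ∈ antidiagonal n, ∑ q ∈ antidiagonal p.2, f q.1 p.1 q.2 := by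
  rw [← sum_antidiagonal_assoc, ← sum_antidiagonal_assoc (fun a b c => f b a c)]
  refine Finset.sum_congr rfl fun p _ => ?_
  exact (Finset.Nat.sum_antidiagonal_swap (n := p.1) (f := fun q => f q.1 q.2 p.2)).symm

/-- The action of `∑ λⁿ sₙ ∈ S[[λ]]` on `V[[λ]]` induced by a representation `ψ` of `S` on `V`. -/
def psAct (ψ : S →ₐ[ℂ] Module.End ℂ V) (s : PowerSeries S) : Formal V →ₗ[ℂ] Formal V where
  toFun v n := ∑ p ∈ antidiagonal n, ψ (PowerSeries.coeff p.1 s) (v p.2)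
  map_add' v w := by funext n; simp [Finset.sum_add_distrib]
  map_smul' r v := by funext n; simp [Finset.smul_sum]

theorem psAct_apply (ψ : S →ₐ[ℂ] Module.End ℂ V) (s : PowerSeries S) (v : Formal V) (n : ℕ) :
    psAct ψ s v n = ∑ p ∈ antidiagonal n, ψ (PowerSeries.coeff p.1 s) (v p.2) := rfl

theorem formalMap_apply (f : V →ₗ[ℂ] W) (v : Formal V) (n : ℕ) : formalMap f v n = f (v n) := rfl

theorem formalMap_zero (v : Formal V) : formalMap (0 : V →ₗ[ℂ] W) v = 0 := rfl

theorem formalMap_add (f h : V →ₗ[ℂ] W) (v : Formal V) :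
    formalMap (f + h) v = formalMap f v + formalMap h v := rfl

theorem formalMap_comp (f : V →ₗ[ℂ] W) (h : W →ₗ[ℂ] X) (v : Formal V) :
    formalMap (h ∘ₗ f) v = formalMap h (formalMap f v) := rfl

theorem psAct_mul (ψ : S →ₐ[ℂ] Module.End ℂ V) (s t : PowerSeries S) (v : Formal V) :
    psAct ψ (s * t) v = psAct ψ s (psAct ψ t v) := by
  funext n
  simp only [psAct_apply, PowerSeries.coeff_mul, map_sum, LinearMap.sum_apply, map_mul,
    Module.End.mul_apply]
  exact sum_antidiagonal_assoc
    (fun a b c => ψ (PowerSeries.coeff a s) (ψ (PowerSeries.coeff b t) (v c))) n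

theorem psAct_one (ψ : S →ₐ[ℂ] Module.End ℂ V) (v : Formal V) : psAct ψ 1 v = v := by
  funext n
  rw [psAct_apply, Finset.sum_eq_single (0, n)]
  · simp
  · rintro ⟨p, q⟩ hp hne
    have : p ≠ 0 := by
      rintro rfl
      simp at hp
      simp [hp] at hne
    simp [PowerSeries.coeff_one, this]
  · simp

theorem psAct_map (ψ : S' →ₐ[ℂ] Module.End ℂ V) (φ : S →ₐ[ℂ] S') (s : PowerSeries S)
    (v : Formal V) :
    psAct ψ (PowerSeries.map φ.toRingHom s) v = psAct (ψ.comp φ) s v := by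
  funext n
  simp [psAct_apply]

/-- A linear map that intertwines two representations intertwines the induced actions of power
series. -/
theorem formalMap_psAct {ψ : S →ₐ[ℂ] Module.End ℂ V} {ψ' : S →ₐ[ℂ] Module.End ℂ W}
    {f : V →ₗ[ℂ] W} (h : ∀ s v, f (ψ s v) = ψ' s (f v)) (s : PowerSeries S) (v : Formal V) :
    formalMap f (psAct ψ s v) = psAct ψ' s (formalMap f v) := by
  funext n
  simp [formalMap_apply, psAct_apply, h]

/-- The `λ`-bilinear tensor product of formal power series. -/
def ftens : Formal X →ₗ[ℂ] Formal Y →ₗ[ℂ] Formal (X ⊗[ℂ] Y) :=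
  formalBilin (TensorProduct.mk ℂ X Y)

theorem ftens_apply (x : Formal X) (y : Formal Y) (n : ℕ) :
    ftens x y n = ∑ p ∈ antidiagonal n, x p.1 ⊗ₜ[ℂ] y p.2 := rfl

theorem ftens_formalMap_left (f : X →ₗ[ℂ] Z) (x : Formal X) (y : Formal Y) :
    ftens (formalMap f x) y = formalMap (f.rTensor Y) (ftens x y) := by
  funext n
  simp [ftens_apply, formalMap_apply]

theorem ftens_formalMap_right (f : Y →ₗ[ℂ] Z) (x : Formal X) (y : Formal Y) :
    ftens x (formalMap f y) = formalMap (f.lTensor X) (ftens x y) := by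
  funext n
  simp [ftens_apply, formalMap_apply]

theorem ftens_comm (x : Formal X) (y : Formal Y) :
    ftens y x = formalMap (TensorProduct.comm ℂ X Y).toLinearMap (ftens x y) := by
  funext n
  simp only [ftens_apply, formalMap_apply, map_sum, LinearEquiv.coe_coe, TensorProduct.comm_tmul]
  exact (Finset.Nat.sum_antidiagonal_swap (n := n) (f := fun q => y q.1 ⊗ₜ[ℂ] x q.2)).symm

theorem ftens_assoc (x : Formal X) (y : Formal Y) (z : Formal Z) :
    ftens x (ftens y z)
      = formalMap (TensorProduct.assoc ℂ X Y Z).toLinearMap (ftens (ftens x y) z) := by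
  funext n
  simp only [ftens_apply, formalMap_apply, map_sum, TensorProduct.sum_tmul,
    TensorProduct.tmul_sum, LinearEquiv.coe_coe, TensorProduct.assoc_tmul]
  exact (sum_antidiagonal_assoc (fun a b c => x a ⊗ₜ[ℂ] (y b ⊗ₜ[ℂ] z c)) n).symm

theorem ftens_single_left (x : X) (y : Formal Y) :
    ftens (Pi.single 0 x) y = formalMap (TensorProduct.mk ℂ X Y x) y := by
  funext n
  rw [ftens_apply, Finset.sum_eq_single (0, n)]
  · simp [formalMap_apply]
  · rintro ⟨p, q⟩ hp hne
    have : p ≠ 0 := by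
      rintro rfl
      simp at hp
      simp [hp] at hne
    simp [this]
  · simp

theorem ftens_single_right (x : Formal X) (y : Y) :
    ftens x (Pi.single 0 y) = formalMap ((TensorProduct.mk ℂ X Y).flip y) x := by
  rw [ftens_comm, ftens_single_left]
  rfl

/-- The representation of `S ⊗ S'` on `X ⊗ Y` given by representations of `S` on `X` and of `S'`
on `Y`. -/
def act2 (a : S →ₐ[ℂ] Module.End ℂ X) (b : S' →ₐ[ℂ] Module.End ℂ Y) :
    S ⊗[ℂ] S' →ₐ[ℂ] Module.End ℂ (X ⊗[ℂ] Y) :=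
  (Module.endTensorEndAlgHom (R := ℂ) (S := ℂ) (A := ℂ)).comp (Algebra.TensorProduct.map a b)

@[simp] theorem act2_tmul (a : S →ₐ[ℂ] Module.End ℂ X) (b : S' →ₐ[ℂ] Module.End ℂ Y)
    (s : S) (s' : S') (x : X) (y : Y) :
    act2 a b (s ⊗ₜ[ℂ] s') (x ⊗ₜ[ℂ] y) = a s x ⊗ₜ[ℂ] b s' y := rfl

theorem ftens_psAct_left (a : S →ₐ[ℂ] Module.End ℂ X) (b : S' →ₐ[ℂ] Module.End ℂ Y)
    (s : PowerSeries S) (x : Formal X) (y : Formal Y) :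
    ftens (psAct a s x) y
      = psAct (act2 a b) (PowerSeries.map
          (Algebra.TensorProduct.includeLeft : S →ₐ[ℂ] S ⊗[ℂ] S').toRingHom s) (ftens x y) := by
  funext n
  rw [psAct_map]
  simp only [ftens_apply, psAct_apply, map_sum, TensorProduct.sum_tmul,
    AlgHom.comp_apply, Algebra.TensorProduct.includeLeft_apply, act2_tmul, map_one,
    Module.End.one_apply]
  exact sum_antidiagonal_assoc (fun i j k => a (PowerSeries.coeff i s) (x j) ⊗ₜ[ℂ] y k) n

theorem ftens_psAct_right (a : S →ₐ[ℂ] Module.End ℂ X) (b : S' →ₐ[ℂ] Module.End ℂ Y)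
    (s : PowerSeries S') (x : Formal X) (y : Formal Y) :
    ftens x (psAct b s y)
      = psAct (act2 a b) (PowerSeries.map
          (Algebra.TensorProduct.includeRight : S' →ₐ[ℂ] S ⊗[ℂ] S').toRingHom s) (ftens x y) := by
  funext n
  rw [psAct_map]
  simp only [ftens_apply, psAct_apply, map_sum, TensorProduct.tmul_sum,
    AlgHom.comp_apply, Algebra.TensorProduct.includeRight_apply, act2_tmul, map_one,
    Module.End.one_apply]
  exact sum_antidiagonal_left_comm (fun i j k => x i ⊗ₜ[ℂ] b (PowerSeries.coeff j s) (y k)) n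

/-- Multiplication by the formal parameter `λ`. -/
def shift {M : Type*} [AddCommGroup M] (x : Formal M) : Formal M
  | 0 => 0
  | n + 1 => x n

/-- Linearity over `ℂ[λ]`, for a map that is already `ℂ`-linear: compatibility with
multiplication by `λ`. -/
def ShiftLinear (Ψ : Formal X →ₗ[ℂ] Formal Y) : Prop := ∀ x, Ψ (shift x) = shift (Ψ x)

theorem shiftLinear_formalMap (f : X →ₗ[ℂ] Y) : ShiftLinear (formalMap f) := by
  intro x
  funext n
  cases n
  · exact map_zero f
  · rfl

theorem shiftLinear_psAct (ψ : S →ₐ[ℂ] Module.End ℂ V) (s : PowerSeries S) :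
    ShiftLinear (psAct ψ s) := by
  intro x
  funext n
  cases n with
  | zero => simp [psAct_apply, shift]
  | succ n =>
    rw [psAct_apply, Finset.Nat.sum_antidiagonal_succ']
    simp [shift, psAct_apply]

theorem shiftLinear_ftens (y : Formal Y) :
    ShiftLinear ((ftens (X := X)).flip y) := by
  intro x
  funext n
  cases n with
  | zero => simp [ftens_apply, shift]
  | succ n =>
    rw [LinearMap.flip_apply, ftens_apply, Finset.Nat.sum_antidiagonal_succ]
    simp [shift, ftens_apply]

theorem ShiftLinear.comp {Ψ : Formal X →ₗ[ℂ] Formal Y} {Ψ' : Formal Y →ₗ[ℂ] Formal Z}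
    (h' : ShiftLinear Ψ') (h : ShiftLinear Ψ) : ShiftLinear (Ψ' ∘ₗ Ψ) := by
  intro x
  simp only [LinearMap.comp_apply, h x, h' (Ψ x)]

theorem shift_iterate_apply {M : Type*} [AddCommGroup M] (k n : ℕ) (x : Formal M) :
    shift^[k] x n = if k ≤ n then x (n - k) else 0 := by
  induction k generalizing n with
  | zero => simp
  | succ k ih =>
    rw [Function.iterate_succ_apply']
    cases n with
    | zero => simp [shift]
    | succ n => simp [shift, ih]

theorem ShiftLinear.iterate {Ψ : Formal X →ₗ[ℂ] Formal Y} (h : ShiftLinear Ψ) (k : ℕ)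
    (x : Formal X) : Ψ (shift^[k] x) = shift^[k] (Ψ x) := by
  induction k with
  | zero => rfl
  | succ k ih => rw [Function.iterate_succ_apply', Function.iterate_succ_apply', h, ih]

/-- A `λ`-linear map is continuous for the `λ`-adic topology: it commutes with sums `∑ λᵏ xₖ`. -/
theorem ShiftLinear.map_series {Ψ : Formal X →ₗ[ℂ] Formal Y} (h : ShiftLinear Ψ)
    (x : ℕ → Formal X) (n : ℕ) :
    Ψ (fun m => ∑ p ∈ antidiagonal m, x p.1 p.2) n = ∑ p ∈ antidiagonal n, Ψ (x p.1) p.2 := by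
  -- Up to order `n` the series is a finite sum; the remainder is a multiple of `λⁿ⁺¹`.
  have key : (fun m => ∑ p ∈ antidiagonal m, x p.1 p.2)
      = (∑ k ∈ Finset.range (n + 1), shift^[k] (x k))
        + shift^[n + 1] (fun m => (fun m => ∑ p ∈ antidiagonal m, x p.1 p.2) (m + (n + 1))
          - (∑ k ∈ Finset.range (n + 1), shift^[k] (x k)) (m + (n + 1))) := by
    funext m
    rw [Pi.add_apply, shift_iterate_apply]
    by_cases hm : n + 1 ≤ m
    · simp only [hm, if_true, Nat.sub_add_cancel hm]
      abel
    · rw [if_neg hm, add_zero, Finset.sum_apply,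
        Finset.Nat.sum_antidiagonal_eq_sum_range_succ_mk]
      have hm' : m + 1 ≤ n + 1 := by omega
      rw [← Finset.sum_subset (Finset.range_subset_range.2 hm')]
      · refine Finset.sum_congr rfl fun k hk => ?_
        rw [shift_iterate_apply, if_pos (Nat.lt_succ_iff.1 (Finset.mem_range.1 hk))]
      · intro k _ hk
        rw [shift_iterate_apply, if_neg]
        simpa [Nat.lt_succ_iff] using hk
  rw [key, map_add, map_sum, Pi.add_apply, h.iterate, shift_iterate_apply, if_neg (by omega),
    add_zero, Finset.sum_apply, Finset.Nat.sum_antidiagonal_eq_sum_range_succ_mk]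
  refine Finset.sum_congr rfl fun k hk => ?_
  rw [h.iterate, shift_iterate_apply, if_pos (Nat.lt_succ_iff.1 (Finset.mem_range.1 hk))]

end PowerSeriesAction

/-! ### Equivariant bilinear maps -/

section Equivariance

variable {g : Type*} [LieRing g] [LieAlgebra ℂ g]
  {X Y Z W V : Type*} [AddCommGroup X] [Module ℂ X] [AddCommGroup Y] [Module ℂ Y]
  [AddCommGroup Z] [Module ℂ Z] [AddCommGroup W] [Module ℂ W] [AddCommGroup V] [Module ℂ V]

/-- `Ug` is generated by `g` as an algebra. -/
theorem env_induction {P : Env g → Prop} (hι : ∀ t, P (UniversalEnvelopingAlgebra.ι ℂ t))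
    (hr : ∀ r, P (algebraMap ℂ _ r)) (hadd : ∀ ξ η, P ξ → P η → P (ξ + η))
    (hmul : ∀ ξ η, P ξ → P η → P (ξ * η)) (ξ : Env g) : P ξ := by
  let S : Subalgebra ℂ (Env g) :=
    { carrier := {ξ | P ξ}
      mul_mem' := fun h h' => hmul _ _ h h'
      add_mem' := fun h h' => hadd _ _ h h'
      algebraMap_mem' := hr }
  -- `Ug` maps to the subalgebra by the universal property, and the composite with the
  -- inclusion is the identity.
  let f : Env g →ₐ[ℂ] S := UniversalEnvelopingAlgebra.lift ℂ
    { toFun := fun t => ⟨UniversalEnvelopingAlgebra.ι ℂ t, hι t⟩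
      map_add' := fun s t => Subtype.ext (map_add _ s t)
      map_smul' := fun r t => Subtype.ext (map_smul _ r t)
      map_lie' := fun {s t} => Subtype.ext (LieHom.map_lie _ s t) }
  have hf : S.val.comp f = AlgHom.id ℂ (Env g) := by
    apply UniversalEnvelopingAlgebra.hom_ext
    ext t
    change ((f (UniversalEnvelopingAlgebra.ι ℂ t) : S) : Env g) = _
    rw [UniversalEnvelopingAlgebra.lift_ι_apply]
    rfl
  have h := (f ξ).2
  change P (S.val.comp f ξ) at h
  rwa [hf] at h

theorem coproduct_ι (t : g) : coproduct g (UniversalEnvelopingAlgebra.ι ℂ t)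
    = UniversalEnvelopingAlgebra.ι ℂ t ⊗ₜ[ℂ] 1 + 1 ⊗ₜ[ℂ] UniversalEnvelopingAlgebra.ι ℂ t :=
  UniversalEnvelopingAlgebra.lift_ι_apply ℂ _ t

theorem counit_ι (t : g) : counit g (UniversalEnvelopingAlgebra.ι ℂ t) = 0 :=
  UniversalEnvelopingAlgebra.lift_ι_apply ℂ _ t

/-- The coproduct of `Ug` is cocommutative. -/
theorem comm_comp_coproduct :
    (Algebra.TensorProduct.comm ℂ (Env g) (Env g)).toAlgHom.comp (coproduct g) = coproduct g := by
  apply UniversalEnvelopingAlgebra.hom_ext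
  ext t
  simp only [LieHom.comp_apply, AlgHom.coe_toLieHom, AlgHom.comp_apply, coproduct_ι, map_add]
  exact add_comm _ _

/-- The linear map `f` commutes with the actions `a` and `b` of `Ug`. -/
def Intertwines (a : Env g →ₐ[ℂ] Module.End ℂ X) (b : Env g →ₐ[ℂ] Module.End ℂ Y)
    (f : X →ₗ[ℂ] Y) : Prop :=
  ∀ ξ x, f (a ξ x) = b ξ (f x)

theorem intertwines_of_lie {a : Env g →ₐ[ℂ] Module.End ℂ X} {b : Env g →ₐ[ℂ] Module.End ℂ Y}
    {f : X →ₗ[ℂ] Y}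
    (h : ∀ t x, f (a (UniversalEnvelopingAlgebra.ι ℂ t) x)
      = b (UniversalEnvelopingAlgebra.ι ℂ t) (f x)) : Intertwines a b f := by
  intro ξ
  induction ξ using env_induction with
  | hι t => exact h t
  | hr r => intro x; simp [Module.algebraMap_end_apply]
  | hadd ξ η hξ hη => intro x; simp [hξ, hη]
  | hmul ξ η hξ hη => intro x; simp [hξ, hη]

/-- The vector `x` is invariant: `Ug` acts on it through the counit. -/
def Invariant (a : Env g →ₐ[ℂ] Module.End ℂ X) (x : X) : Prop :=
  ∀ ξ, a ξ x = counit g ξ • x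

theorem invariant_of_lie {a : Env g →ₐ[ℂ] Module.End ℂ X} {x : X}
    (h : ∀ t, a (UniversalEnvelopingAlgebra.ι ℂ t) x = 0) : Invariant a x := by
  intro ξ
  induction ξ using env_induction with
  | hι t => rw [h, counit_ι, zero_smul]
  | hr r => simp [Module.algebraMap_end_apply]
  | hadd ξ η hξ hη => simp [hξ, hη, add_smul]
  | hmul ξ η hξ hη =>
    rw [map_mul, Module.End.mul_apply, hη, map_smul, hξ, map_mul, mul_smul, smul_comm]

/-- The bilinear map `ν` is `Ug`-equivariant: `ξ(ν(x, y)) = ν(ξ₁(x), ξ₂(y))` for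
`Δ ξ = ξ₁ ⊗ ξ₂`. -/
def Equivariant (a : Env g →ₐ[ℂ] Module.End ℂ X) (b : Env g →ₐ[ℂ] Module.End ℂ Y)
    (c : Env g →ₐ[ℂ] Module.End ℂ Z) (ν : X →ₗ[ℂ] Y →ₗ[ℂ] Z) : Prop :=
  Intertwines ((act2 a b).comp (coproduct g)) c (TensorProduct.lift ν)

/-- A bilinear map is `Ug`-equivariant if the elements of `g` act on it by the Leibniz rule. -/
theorem equivariant_of_lie {a : Env g →ₐ[ℂ] Module.End ℂ X} {b : Env g →ₐ[ℂ] Module.End ℂ Y}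
    {c : Env g →ₐ[ℂ] Module.End ℂ Z} {ν : X →ₗ[ℂ] Y →ₗ[ℂ] Z}
    (h : ∀ t x y, c (UniversalEnvelopingAlgebra.ι ℂ t) (ν x y)
      = ν (a (UniversalEnvelopingAlgebra.ι ℂ t) x) y
        + ν x (b (UniversalEnvelopingAlgebra.ι ℂ t) y)) : Equivariant a b c ν := by
  refine intertwines_of_lie fun t u => ?_
  induction u using TensorProduct.induction_on with
  | zero => simp
  | tmul x y =>
    rw [AlgHom.comp_apply, coproduct_ι, map_add, LinearMap.add_apply, act2_tmul, act2_tmul,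
      map_add, map_one, map_one]
    exact (h t x y).symm
  | add u v hu hv => simp only [map_add, hu, hv]

theorem Equivariant.leibniz {a : Env g →ₐ[ℂ] Module.End ℂ X} {b : Env g →ₐ[ℂ] Module.End ℂ Y}
    {c : Env g →ₐ[ℂ] Module.End ℂ Z} {ν : X →ₗ[ℂ] Y →ₗ[ℂ] Z} (h : Equivariant a b c ν)
    (t : g) (x : X) (y : Y) :
    c (UniversalEnvelopingAlgebra.ι ℂ t) (ν x y)
      = ν (a (UniversalEnvelopingAlgebra.ι ℂ t) x) y
        + ν x (b (UniversalEnvelopingAlgebra.ι ℂ t) y) := by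
  have h' := h (UniversalEnvelopingAlgebra.ι ℂ t) (x ⊗ₜ[ℂ] y)
  rw [AlgHom.comp_apply, coproduct_ι, map_add, LinearMap.add_apply, act2_tmul, act2_tmul,
    map_add, map_one, map_one] at h'
  exact h'.symm

theorem Equivariant.compl₂ {a : Env g →ₐ[ℂ] Module.End ℂ X} {b : Env g →ₐ[ℂ] Module.End ℂ Y}
    {b' : Env g →ₐ[ℂ] Module.End ℂ W} {c : Env g →ₐ[ℂ] Module.End ℂ Z}
    {ν : X →ₗ[ℂ] Y →ₗ[ℂ] Z} {f : W →ₗ[ℂ] Y} (h : Equivariant a b c ν) (hf : Intertwines b' b f) :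
    Equivariant a b' c (ν.compl₂ f) :=
  equivariant_of_lie fun t x w => by
    simp only [LinearMap.compl₂_apply]
    rw [h.leibniz, hf]

end Equivariance

/-! ### Deformed bilinear maps and their compositions -/

section Deformation

variable {g : Type*} [LieRing g] [LieAlgebra ℂ g]
  {X Y Z W W' V : Type*} [AddCommGroup X] [Module ℂ X] [AddCommGroup Y] [Module ℂ Y]
  [AddCommGroup Z] [Module ℂ Z] [AddCommGroup W] [Module ℂ W] [AddCommGroup W'] [Module ℂ W']
  [AddCommGroup V] [Module ℂ V]
  {a : Env g →ₐ[ℂ] Module.End ℂ X} {b : Env g →ₐ[ℂ] Module.End ℂ Y}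
  {c : Env g →ₐ[ℂ] Module.End ℂ Z} {d : Env g →ₐ[ℂ] Module.End ℂ W}
  {d' : Env g →ₐ[ℂ] Module.End ℂ W'}

/-- Twisting a `λ`-linear function `Ψ` of the tensor product amounts to acting on its argument: the
sum over the orders of the series `S` may be pulled inside `Ψ`. -/
theorem twistBy_eq {B : Formal X →ₗ[ℂ] Formal Y →ₗ[ℂ] Formal Z}
    {Ψ : Formal (X ⊗[ℂ] Y) →ₗ[ℂ] Formal Z} (hΨ : ShiftLinear Ψ)
    (hB : ∀ x y, B x y = Ψ (ftens x y)) (S : PowerSeries (Env g ⊗[ℂ] Env g))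
    (x : Formal X) (y : Formal Y) :
    twistBy S a b B x y = Ψ (psAct (act2 a b) S (ftens x y)) := by
  have key : ∀ s, TensorProduct.lift (actPair a b B x y) s
      = Ψ (formalMap (act2 a b s) (ftens x y)) := by
    intro s
    induction s using TensorProduct.induction_on with
    | zero => rw [map_zero, map_zero, formalMap_zero, map_zero]
    | tmul ξ η =>
      rw [TensorProduct.lift.tmul]
      change B (formalMap (a ξ) x) (formalMap (b η) y) = _
      rw [hB, ftens_formalMap_left, ftens_formalMap_right, ← formalMap_comp]
      congr 2
      refine congrArg formalMap (TensorProduct.ext' fun x y => rfl)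
    | add s t hs ht =>
      rw [map_add, hs, ht, map_add, formalMap_add, map_add]
  funext n
  have h := hΨ.map_series
    (fun k => formalMap (act2 a b (PowerSeries.coeff k S)) (ftens x y)) n
  simp only [← key] at h
  exact h.symm

theorem twistBy_add (S : PowerSeries (Env g ⊗[ℂ] Env g))
    (B B' : Formal X →ₗ[ℂ] Formal Y →ₗ[ℂ] Formal Z) (x : Formal X) (y : Formal Y) :
    twistBy S a b (B + B') x y = twistBy S a b B x y + twistBy S a b B' x y := by
  have h : TensorProduct.lift (actPair a b (B + B') x y)
      = TensorProduct.lift (actPair a b B x y) + TensorProduct.lift (actPair a b B' x y) :=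
    TensorProduct.ext' fun ξ η => rfl
  funext n
  change ∑ p ∈ antidiagonal n, TensorProduct.lift (actPair a b (B + B') x y)
    (PowerSeries.coeff p.1 S) p.2 = _
  rw [h]
  exact Finset.sum_add_distrib

theorem twistBy_zero (S : PowerSeries (Env g ⊗[ℂ] Env g)) (x : Formal X) (y : Formal Y) :
    twistBy S a b (0 : Formal X →ₗ[ℂ] Formal Y →ₗ[ℂ] Formal Z) x y = 0 := by
  have h := twistBy_add (a := a) (b := b) S
    (0 : Formal X →ₗ[ℂ] Formal Y →ₗ[ℂ] Formal Z) 0 x y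
  rw [add_zero] at h
  exact left_eq_add.1 h

theorem twistBy_sum {κ : Type*} (s : Finset κ) (S : PowerSeries (Env g ⊗[ℂ] Env g))
    (B : κ → Formal X →ₗ[ℂ] Formal Y →ₗ[ℂ] Formal Z) (x : Formal X) (y : Formal Y) :
    twistBy S a b (∑ k ∈ s, B k) x y = ∑ k ∈ s, twistBy S a b (B k) x y := by
  classical
  induction s using Finset.induction_on with
  | empty => simp only [Finset.sum_empty, twistBy_zero]
  | insert k s hk ih => rw [Finset.sum_insert hk, Finset.sum_insert hk, twistBy_add, ih]

/-- A `λ`-linear map may be applied before or after twisting a bilinear map. -/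
theorem map_twistBy {Ψ : Formal Z →ₗ[ℂ] Formal W} (hΨ : ShiftLinear Ψ)
    (S : PowerSeries (Env g ⊗[ℂ] Env g)) (B : Formal X →ₗ[ℂ] Formal Y →ₗ[ℂ] Formal Z)
    (x : Formal X) (y : Formal Y) :
    Ψ (twistBy S a b B x y) = twistBy S a b (B.compr₂ Ψ) x y := by
  have h : TensorProduct.lift (actPair a b (B.compr₂ Ψ) x y)
      = Ψ ∘ₗ TensorProduct.lift (actPair a b B x y) := TensorProduct.ext' fun ξ η => rfl
  funext n
  refine (hΨ.map_series
    (fun k => TensorProduct.lift (actPair a b B x y) (PowerSeries.coeff k S)) n).trans ?_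
  change _ = ∑ p ∈ antidiagonal n, TensorProduct.lift (actPair a b (B.compr₂ Ψ) x y)
    (PowerSeries.coeff p.1 S) p.2
  rw [h]
  rfl

theorem formalBilin_eq (μ : X →ₗ[ℂ] Y →ₗ[ℂ] Z) (x : Formal X) (y : Formal Y) :
    formalBilin μ x y = formalMap (TensorProduct.lift μ) (ftens x y) := by
  funext n
  simp [formalBilin, formalMap_apply, ftens_apply]

theorem starOf_eq (T : Twist g) (μ : X →ₗ[ℂ] Y →ₗ[ℂ] Z) (x : Formal X) (y : Formal Y) :
    starOf T a b μ x y
      = formalMap (TensorProduct.lift μ) (psAct (act2 a b) (T.F⁻¹).val (ftens x y)) :=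
  twistBy_eq (shiftLinear_formalMap _) (formalBilin_eq μ) _ x y

theorem starOf_add (T : Twist g) (μ μ' : X →ₗ[ℂ] Y →ₗ[ℂ] Z) (x : Formal X) (y : Formal Y) :
    starOf T a b (μ + μ') x y = starOf T a b μ x y + starOf T a b μ' x y := by
  have h : TensorProduct.lift (μ + μ') = TensorProduct.lift μ + TensorProduct.lift μ' :=
    TensorProduct.ext' fun x y => rfl
  rw [starOf_eq, starOf_eq, starOf_eq, h, formalMap_add]

theorem shiftLinear_starOf_left (T : Twist g) (μ : X →ₗ[ℂ] Y →ₗ[ℂ] Z) (y : Formal Y) :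
    ShiftLinear ((starOf T a b μ).flip y) := by
  have h : (starOf T a b μ).flip y
      = formalMap (TensorProduct.lift μ) ∘ₗ psAct (act2 a b) (T.F⁻¹).val ∘ₗ ftens.flip y :=
    LinearMap.ext fun x => starOf_eq T μ x y
  rw [h]
  exact (shiftLinear_formalMap _).comp ((shiftLinear_psAct _ _).comp (shiftLinear_ftens y))

theorem formalMap_starOf (T : Twist g) (μ : X →ₗ[ℂ] Y →ₗ[ℂ] Z) (f : Z →ₗ[ℂ] W)
    (x : Formal X) (y : Formal Y) :
    formalMap f (starOf T a b μ x y) = starOf T a b (μ.compr₂ f) x y := by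
  rw [starOf_eq, starOf_eq, ← formalMap_comp]
  congr 1
  congr 1
  exact TensorProduct.ext' fun x y => rfl

theorem starOf_formalMap_right (T : Twist g) (μ : X →ₗ[ℂ] Z →ₗ[ℂ] W) {f : Y →ₗ[ℂ] Z}
    (hf : Intertwines b c f) (x : Formal X) (y : Formal Y) :
    starOf T a c μ x (formalMap f y) = starOf T a b (μ.compl₂ f) x y := by
  rw [starOf_eq, starOf_eq, ftens_formalMap_right, ← formalMap_psAct (ψ := act2 a b),
    ← formalMap_comp]
  · congr 1
    congr 1
    exact TensorProduct.ext' fun x y => rfl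
  · intro s v
    induction s using TensorProduct.induction_on with
    | zero => simp
    | add s t hs ht => simp only [map_add, LinearMap.add_apply, hs, ht]
    | tmul ξ η =>
      induction v using TensorProduct.induction_on with
      | zero => simp
      | add u v hu hv => simp only [map_add, hu, hv]
      | tmul x y => simp [hf η y]

theorem starOf_formalMap_left (T : Twist g) (μ : Z →ₗ[ℂ] Y →ₗ[ℂ] W) {f : X →ₗ[ℂ] Z}
    (hf : Intertwines a c f) (x : Formal X) (y : Formal Y) :
    starOf T c b μ (formalMap f x) y = starOf T a b (μ.comp f) x y := by
  rw [starOf_eq, starOf_eq, ftens_formalMap_left, ← formalMap_psAct (ψ := act2 a b),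
    ← formalMap_comp]
  · congr 1
    congr 1
    exact TensorProduct.ext' fun x y => rfl
  · intro s v
    induction s using TensorProduct.induction_on with
    | zero => simp
    | add s t hs ht => simp only [map_add, LinearMap.add_apply, hs, ht]
    | tmul ξ η =>
      induction v using TensorProduct.induction_on with
      | zero => simp
      | add u v hu hv => simp only [map_add, hu, hv]
      | tmul x y => simp [hf ξ x]

theorem map_inv_eq_one {S S' : Type*} [Ring S] [Ring S'] (F : (PowerSeries S)ˣ)
    (f : S →+* S') (h : PowerSeries.map f F.val = 1) : PowerSeries.map f (F⁻¹).val = 1 := by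
  have := congrArg (PowerSeries.map f) F.mul_inv
  rwa [map_mul, h, one_mul, map_one] at this

/-- The deformation does not affect the product with an invariant element in the second
argument, by the normalization of the twist. -/
theorem starOf_invariant_right (T : Twist g) (μ : X →ₗ[ℂ] Y →ₗ[ℂ] Z) {y : Y}
    (hy : Invariant b y) (x : Formal X) :
    starOf T a b μ x (Pi.single 0 y) = formalMap (μ.flip y) x := by
  rw [starOf_eq, ftens_single_right, ← formalMap_psAct
    (ψ := a.comp ((Algebra.TensorProduct.rid ℂ ℂ (Env g)).toAlgHom.comp
      (Algebra.TensorProduct.map (AlgHom.id ℂ (Env g)) (counit g)))), ← psAct_map,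
    map_inv_eq_one _ _ T.counit_right, psAct_one]
  · rfl
  · intro s x
    induction s using TensorProduct.induction_on with
    | zero => simp
    | add s t hs ht => simp only [map_add, LinearMap.add_apply, hs, ht]
    | tmul ξ η =>
      change a (counit g η • ξ) x ⊗ₜ[ℂ] y = a ξ x ⊗ₜ[ℂ] b η y
      rw [map_smul, hy, LinearMap.smul_apply, TensorProduct.tmul_smul, TensorProduct.smul_tmul']

/-- The deformation does not affect the product with an invariant element in the first
argument, by the normalization of the twist. -/
theorem starOf_invariant_left (T : Twist g) (μ : X →ₗ[ℂ] Y →ₗ[ℂ] Z) {x : X}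
    (hx : Invariant a x) (y : Formal Y) :
    starOf T a b μ (Pi.single 0 x) y = formalMap (μ x) y := by
  rw [starOf_eq, ftens_single_left, ← formalMap_psAct
    (ψ := b.comp ((Algebra.TensorProduct.lid ℂ (Env g)).toAlgHom.comp
      (Algebra.TensorProduct.map (counit g) (AlgHom.id ℂ (Env g))))), ← psAct_map,
    map_inv_eq_one _ _ T.counit_left, psAct_one]
  · rfl
  · intro s y
    induction s using TensorProduct.induction_on with
    | zero => simp
    | add s t hs ht => simp only [map_add, LinearMap.add_apply, hs, ht]
    | tmul ξ η =>
      change x ⊗ₜ[ℂ] b (counit g ξ • η) y = a ξ x ⊗ₜ[ℂ] b η y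
      rw [map_smul, hx, LinearMap.smul_apply, TensorProduct.tmul_smul, TensorProduct.smul_tmul']

/-- The lowest-order coefficient of a deformed product is the undeformed product: if
`x = O(λⁿ)`, then the `λⁿ`-coefficient of `μ_⋆(y, x)` is `μ(y₀, xₙ)`. -/
theorem starOf_apply_of_lt (T : Twist g) (μ : Y →ₗ[ℂ] X →ₗ[ℂ] Z) (y : Formal Y)
    (x : Formal X) (n : ℕ) (hx : ∀ k < n, x k = 0) :
    starOf T b a μ y x n = μ (y 0) (x n) := by
  have h0 : PowerSeries.coeff 0 (T.F⁻¹).val = 1 := by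
    have h := congrArg PowerSeries.constantCoeff T.F.mul_inv
    rwa [map_mul, T.leading, one_mul, map_one, ← PowerSeries.coeff_zero_eq_constantCoeff_apply]
      at h
  have ht : ∀ k ≤ n, ftens y x k = if k = n then y 0 ⊗ₜ[ℂ] x n else 0 := by
    intro k hk
    rw [ftens_apply]
    split_ifs with hkn
    · subst hkn
      rw [Finset.sum_eq_single (0, k)]
      · rintro ⟨p, q⟩ hp hne
        have hq : q < k := by
          simp only [Finset.HasAntidiagonal.mem_antidiagonal] at hp
          have : p ≠ 0 := by
            rintro rfl
            simp at hp
            simp [hp] at hne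
          omega
        rw [hx q hq, TensorProduct.tmul_zero]
      · simp
    · refine Finset.sum_eq_zero fun p hp => ?_
      simp only [Finset.HasAntidiagonal.mem_antidiagonal] at hp
      rw [hx p.2 (by omega), TensorProduct.tmul_zero]
  rw [starOf_eq, formalMap_apply, psAct_apply, Finset.sum_eq_single (0, n)]
  · simp [h0, ht n le_rfl]
  · rintro ⟨p, q⟩ hp hne
    simp only [Finset.HasAntidiagonal.mem_antidiagonal] at hp
    have hq : q ≠ n := by
      rintro rfl
      have : p = 0 := by omega
      simp [this] at hne
    rw [ht q (by omega), if_neg hq, map_zero]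
  · simp

/-- The element `Φ = (Δ ⊗ id)(ℱ⁻¹) ℱ₁₂⁻¹ = (id ⊗ Δ)(ℱ⁻¹) ℱ₂₃⁻¹` of `(Ug ⊗ Ug ⊗ Ug)[[λ]]`, through
which iterated deformed products are obtained from the undeformed ones. -/
def Twist.cube (T : Twist g) : PowerSeries ((Env g ⊗[ℂ] Env g) ⊗[ℂ] Env g) :=
  PowerSeries.map (Algebra.TensorProduct.map (coproduct g) (AlgHom.id ℂ (Env g))).toRingHom
      (T.F⁻¹).val
    * PowerSeries.map (Algebra.TensorProduct.includeLeft :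
        Env g ⊗[ℂ] Env g →ₐ[ℂ] (Env g ⊗[ℂ] Env g) ⊗[ℂ] Env g).toRingHom (T.F⁻¹).val

/-- The cocycle condition, for the inverse of the twist. -/
theorem Twist.map_assoc_cube (T : Twist g) :
    PowerSeries.map
        (Algebra.TensorProduct.assoc ℂ ℂ ℂ (Env g) (Env g) (Env g)).toAlgHom.toRingHom T.cube
      = PowerSeries.map
          (Algebra.TensorProduct.map (AlgHom.id ℂ (Env g)) (coproduct g)).toRingHom (T.F⁻¹).val
        * PowerSeries.map (Algebra.TensorProduct.includeRight :
          Env g ⊗[ℂ] Env g →ₐ[ℂ] Env g ⊗[ℂ] (Env g ⊗[ℂ] Env g)).toRingHom (T.F⁻¹).val := by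
  let u {S : Type _} [Ring S] (f : Env g ⊗[ℂ] Env g →+* S) : (PowerSeries S)ˣ :=
    Units.map (PowerSeries.map f).toMonoidHom T.F
  have h := congrArg (fun v => (v⁻¹).val) (Units.ext T.cocycle :
    u _ * u _ = u _ * u _)
  simp only [mul_inv_rev, Units.val_mul] at h
  rw [Twist.cube, map_mul]
  refine Eq.trans ?_ h
  congr 1

/-- The deformation `m ∘ Φ` of a trilinear map `m`. -/
def triStar (T : Twist g) (a : Env g →ₐ[ℂ] Module.End ℂ X) (b : Env g →ₐ[ℂ] Module.End ℂ Y)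
    (c : Env g →ₐ[ℂ] Module.End ℂ Z) (m : (X ⊗[ℂ] Y) ⊗[ℂ] Z →ₗ[ℂ] V)
    (x : Formal X) (y : Formal Y) (z : Formal Z) : Formal V :=
  formalMap m (psAct (act2 (act2 a b) c) T.cube (ftens (ftens x y) z))

theorem triStar_add (T : Twist g) (m m' : (X ⊗[ℂ] Y) ⊗[ℂ] Z →ₗ[ℂ] V)
    (x : Formal X) (y : Formal Y) (z : Formal Z) :
    triStar T a b c (m + m') x y z = triStar T a b c m x y z + triStar T a b c m' x y z := rfl

theorem rTensor_act2_map {S S₁ S₁' : Type*} [Ring S] [Algebra ℂ S] [Ring S₁] [Algebra ℂ S₁]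
    [Ring S₁'] [Algebra ℂ S₁'] (α : S₁ →ₐ[ℂ] Module.End ℂ X) (α' : S₁' →ₐ[ℂ] Module.End ℂ Y)
    (β : S →ₐ[ℂ] Module.End ℂ Z) (φ : S₁' →ₐ[ℂ] S₁) (f : X →ₗ[ℂ] Y)
    (h : ∀ s x, f (α (φ s) x) = α' s (f x)) (s : S₁' ⊗[ℂ] S) (t : X ⊗[ℂ] Z) :
    f.rTensor Z (act2 α β (Algebra.TensorProduct.map φ (AlgHom.id ℂ S) s) t)
      = act2 α' β s (f.rTensor Z t) := by
  induction s using TensorProduct.induction_on with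
  | zero => simp
  | add s t hs ht => simp only [map_add, LinearMap.add_apply, hs, ht]
  | tmul ξ η =>
    induction t using TensorProduct.induction_on with
    | zero => simp
    | add u v hu hv => simp only [map_add, hu, hv]
    | tmul x y => simp [h]

theorem lTensor_act2_map {S S₁ S₁' : Type*} [Ring S] [Algebra ℂ S] [Ring S₁] [Algebra ℂ S₁]
    [Ring S₁'] [Algebra ℂ S₁'] (α : S₁ →ₐ[ℂ] Module.End ℂ X) (α' : S₁' →ₐ[ℂ] Module.End ℂ Y)
    (β : S →ₐ[ℂ] Module.End ℂ Z) (φ : S₁' →ₐ[ℂ] S₁) (f : X →ₗ[ℂ] Y)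
    (h : ∀ s x, f (α (φ s) x) = α' s (f x)) (s : S ⊗[ℂ] S₁') (t : Z ⊗[ℂ] X) :
    f.lTensor Z (act2 β α (Algebra.TensorProduct.map (AlgHom.id ℂ S) φ s) t)
      = act2 β α' s (f.lTensor Z t) := by
  induction s using TensorProduct.induction_on with
  | zero => simp
  | add s t hs ht => simp only [map_add, LinearMap.add_apply, hs, ht]
  | tmul ξ η =>
    induction t using TensorProduct.induction_on with
    | zero => simp
    | add u v hu hv => simp only [map_add, hu, hv]
    | tmul x y => simp [h]

/-- `μ_⋆(ν_⋆(x, y), z)` is the deformation of the trilinear map `μ(ν(x, y), z)`. -/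
theorem starOf_starOf_left (T : Twist g) {ν : X →ₗ[ℂ] Y →ₗ[ℂ] W} (hν : Equivariant a b d ν)
    (μ : W →ₗ[ℂ] Z →ₗ[ℂ] V) (x : Formal X) (y : Formal Y) (z : Formal Z) :
    starOf T d c μ (starOf T a b ν x y) z
      = triStar T a b c (TensorProduct.lift μ ∘ₗ (TensorProduct.lift ν).rTensor Z) x y z := by
  rw [starOf_eq, starOf_eq, ftens_formalMap_left, ftens_psAct_left _ c, triStar, Twist.cube,
    psAct_mul, psAct_map, formalMap_comp]
  congr 1
  symm
  exact formalMap_psAct (ψ := (act2 (act2 a b) c).comp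
    (Algebra.TensorProduct.map (coproduct g) (AlgHom.id ℂ (Env g)))) (rTensor_act2_map (act2 a b) d c (coproduct g) _ hν) _ _

/-- `μ_⋆(x, ν_⋆(y, z))` is the deformation of the trilinear map `μ(x, ν(y, z))`. -/
theorem starOf_starOf_right (T : Twist g) {ν : Y →ₗ[ℂ] Z →ₗ[ℂ] W} (hν : Equivariant b c d ν)
    (μ : X →ₗ[ℂ] W →ₗ[ℂ] V) (x : Formal X) (y : Formal Y) (z : Formal Z) :
    starOf T a d μ x (starOf T b c ν y z)
      = triStar T a b c (TensorProduct.lift μ ∘ₗ (TensorProduct.lift ν).lTensor X ∘ₗ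
          (TensorProduct.assoc ℂ X Y Z).toLinearMap) x y z := by
  have h : ∀ t, formalMap (TensorProduct.assoc ℂ X Y Z).toLinearMap
      (psAct (act2 (act2 a b) c) T.cube t) = psAct (act2 a (act2 b c)) (PowerSeries.map
        (Algebra.TensorProduct.assoc ℂ ℂ ℂ (Env g) (Env g) (Env g)).toAlgHom.toRingHom T.cube)
        (formalMap (TensorProduct.assoc ℂ X Y Z).toLinearMap t) := by
    intro t
    rw [psAct_map]
    refine formalMap_psAct (fun s t => ?_) _ _
    induction s using TensorProduct.induction_on with
    | zero => simp
    | add s t hs ht => simp only [map_add, LinearMap.add_apply, hs, ht]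
    | tmul s ζ =>
      induction s using TensorProduct.induction_on with
      | zero => simp
      | add s t hs ht => simp only [map_add, LinearMap.add_apply, TensorProduct.add_tmul, hs, ht]
      | tmul ξ η =>
        induction t using TensorProduct.induction_on with
        | zero => simp
        | add u v hu hv => simp only [map_add, hu, hv]
        | tmul u z =>
          induction u using TensorProduct.induction_on with
          | zero => simp
          | add u v hu hv => simp only [map_add, TensorProduct.add_tmul, hu, hv]
          | tmul x y => rfl
  rw [starOf_eq, starOf_eq, ftens_formalMap_right, ftens_psAct_right a, triStar, formalMap_comp,
    formalMap_comp, h, ← ftens_assoc, T.map_assoc_cube, psAct_mul, psAct_map _ (_ : _ →ₐ[ℂ] _)]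
  congr 1
  symm
  exact formalMap_psAct (ψ := (act2 a (act2 b c)).comp
    (Algebra.TensorProduct.map (AlgHom.id ℂ (Env g)) (coproduct g))) (lTensor_act2_map (act2 b c) d a (coproduct g) _ hν) _ _

/-- Associativity laws between equivariant maps survive the deformation. -/
theorem starOf_assoc (T : Twist g) {ν : X →ₗ[ℂ] Y →ₗ[ℂ] W} (hν : Equivariant a b d ν)
    {ν' : Y →ₗ[ℂ] Z →ₗ[ℂ] W'} (hν' : Equivariant b c d' ν')
    {μ : W →ₗ[ℂ] Z →ₗ[ℂ] V} {μ' : X →ₗ[ℂ] W' →ₗ[ℂ] V}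
    (h : ∀ x y z, μ (ν x y) z = μ' x (ν' y z)) (x : Formal X) (y : Formal Y) (z : Formal Z) :
    starOf T d c μ (starOf T a b ν x y) z = starOf T a d' μ' x (starOf T b c ν' y z) := by
  rw [starOf_starOf_left T hν, starOf_starOf_right T hν']
  congr 1
  exact TensorProduct.ext_threefold h

/-- The exchange of the first two arguments of a trilinear map. -/
def swap12 (X Y Z : Type*) [AddCommGroup X] [Module ℂ X] [AddCommGroup Y] [Module ℂ Y]
    [AddCommGroup Z] [Module ℂ Z] : (X ⊗[ℂ] Y) ⊗[ℂ] Z →ₗ[ℂ] (Y ⊗[ℂ] X) ⊗[ℂ] Z :=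
  (TensorProduct.comm ℂ X Y).toLinearMap.rTensor Z

/-- `Φ ℛ₁₂⁻¹` is `Φ` with its first two tensor factors exchanged: `ℱ₁₂⁻¹ ℛ₁₂⁻¹ = ℱ₂₁⁻¹`, and
`(Δ ⊗ id)(ℱ⁻¹)` is symmetric in the first two factors. -/
theorem Twist.cube_mul_map_R_inv (T : Twist g) :
    T.cube * PowerSeries.map (Algebra.TensorProduct.includeLeft :
        Env g ⊗[ℂ] Env g →ₐ[ℂ] (Env g ⊗[ℂ] Env g) ⊗[ℂ] Env g).toRingHom (T.R⁻¹).val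
      = PowerSeries.map (Algebra.TensorProduct.map
          (Algebra.TensorProduct.comm ℂ (Env g) (Env g)).toAlgHom
            (AlgHom.id ℂ (Env g))).toRingHom T.cube := by
  have h1 : (T.R⁻¹).val = T.F.val * PowerSeries.map
      (Algebra.TensorProduct.comm ℂ (Env g) (Env g)).toAlgHom.toRingHom (T.F⁻¹).val := by
    rw [Twist.R, mul_inv_rev, inv_inv, Units.val_mul]
    rfl
  have h2 : ∀ s : Env g ⊗[ℂ] Env g,
      Algebra.TensorProduct.map (Algebra.TensorProduct.comm ℂ (Env g) (Env g)).toAlgHom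
        (AlgHom.id ℂ (Env g)) (Algebra.TensorProduct.map (coproduct g) (AlgHom.id ℂ (Env g)) s)
        = Algebra.TensorProduct.map (coproduct g) (AlgHom.id ℂ (Env g)) s := by
    intro s
    rw [← AlgHom.comp_apply, ← Algebra.TensorProduct.map_comp, comm_comp_coproduct]
    rfl
  rw [Twist.cube, h1, map_mul, mul_assoc, ← mul_assoc (PowerSeries.map _ (T.F⁻¹).val)
    (PowerSeries.map _ T.F.val), ← map_mul, T.F.inv_mul, map_one, one_mul, map_mul]
  congr 1
  · ext n
    simp only [PowerSeries.coeff_map]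
    exact (h2 _).symm

/-- The exchange of the first two arguments by `ℛ⁻¹` is the deformation of the plain
exchange. -/
theorem twistBy_R_inv (T : Twist g) (m : (Y ⊗[ℂ] X) ⊗[ℂ] Z →ₗ[ℂ] V) (z : Formal Z)
    {B : Formal Y →ₗ[ℂ] Formal X →ₗ[ℂ] Formal V}
    (hB : ∀ y x, B y x = triStar T b a c m y x z) (x : Formal X) (y : Formal Y) :
    twistBy (T.R⁻¹).val b a B y x = triStar T a b c (m ∘ₗ swap12 X Y Z) x y z := by
  rw [twistBy_eq (Ψ := formalMap m ∘ₗ psAct (act2 (act2 b a) c) T.cube ∘ₗ ftens.flip z)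
    ((shiftLinear_formalMap _).comp ((shiftLinear_psAct _ _).comp (shiftLinear_ftens z))) hB]
  simp only [LinearMap.comp_apply, LinearMap.flip_apply]
  have hm : m = (m ∘ₗ swap12 X Y Z) ∘ₗ swap12 Y X Z := TensorProduct.ext_threefold fun _ _ _ => rfl
  have hs : ∀ s t, swap12 Y X Z (((act2 (act2 b a) c).comp (Algebra.TensorProduct.map
      (Algebra.TensorProduct.comm ℂ (Env g) (Env g)).toAlgHom (AlgHom.id ℂ (Env g)))) s t)
        = act2 (act2 a b) c s (swap12 Y X Z t) := by
    refine rTensor_act2_map (act2 b a) (act2 a b) c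
      (Algebra.TensorProduct.comm ℂ (Env g) (Env g)).toAlgHom
      (TensorProduct.comm ℂ Y X).toLinearMap (fun s t => ?_)
    induction s using TensorProduct.induction_on with
    | zero => simp
    | add s t hs ht => simp only [map_add, LinearMap.add_apply, hs, ht]
    | tmul ξ η =>
      induction t using TensorProduct.induction_on with
      | zero => simp
      | add u v hu hv => simp only [map_add, hu, hv]
      | tmul y x => rfl
  have hf : formalMap (swap12 Y X Z) (ftens (ftens y x) z) = ftens (ftens x y) z := by
    rw [swap12, ← ftens_formalMap_left, ← ftens_comm]
  rw [ftens_psAct_left _ c, ← psAct_mul, T.cube_mul_map_R_inv, psAct_map, triStar]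
  conv_lhs => rw [hm, formalMap_comp, formalMap_psAct hs, hf]

end Deformation

/-! ### Equivariance of the Cartan calculus -/

section CartanEquivariance

variable {A : Type*} [CommRing A] [Algebra ℂ A] {g : Type*} [LieRing g] [LieAlgebra ℂ g]
  (ρ : g →ₗ⁅ℂ⁆ Vec A)

theorem actFun_ι (t : g) (h : A) : actFun ρ (UniversalEnvelopingAlgebra.ι ℂ t) h = ρ t h :=
  congrArg (fun f : Module.End ℂ A => f h) (UniversalEnvelopingAlgebra.lift_ι_apply ℂ _ t)

theorem actVec_ι (t : g) (v : Vec A) :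
    actVec ρ (UniversalEnvelopingAlgebra.ι ℂ t) v = ⁅ρ t, v⁆ :=
  congrArg (fun f : Module.End ℂ (Vec A) => f v) (UniversalEnvelopingAlgebra.lift_ι_apply ℂ _ t)

theorem actForm1_ι_apply (t : g) (α : Form1 A) (v : Vec A) :
    actForm1 ρ (UniversalEnvelopingAlgebra.ι ℂ t) α v = ρ t (α v) - α ⁅ρ t, v⁆ :=
  congrArg (fun f : Module.End ℂ (Form1 A) => f α v)
    (UniversalEnvelopingAlgebra.lift_ι_apply ℂ _ t)

theorem actForm2_ι_apply (t : g) (τ : Form2 A) (v w : Vec A) :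
    (actForm2 ρ (UniversalEnvelopingAlgebra.ι ℂ t) τ).1 v w
      = ρ t (τ.1 v w) - τ.1 ⁅ρ t, v⁆ w - τ.1 v ⁅ρ t, w⁆ :=
  congrArg (fun f : Module.End ℂ (Form2 A) => (f τ).1 v w)
    (UniversalEnvelopingAlgebra.lift_ι_apply ℂ _ t)

variable (A) in
/-- The Lie derivative of endomorphisms of the module of vector fields. -/
def lieEnd : Vec A →ₗ⁅ℂ⁆ Module.End ℂ (Vec A →ₗ[A] Vec A) where
  toFun u :=
    { toFun := fun φ =>
        { toFun := fun v => ⁅u, φ v⁆ - φ ⁅u, v⁆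
          map_add' := fun v w => by simp only [map_add, lie_add]; abel
          map_smul' := fun c v => by
            simp only [map_smul, map_add, vec_lie_smul, smul_sub, RingHom.id_apply]; abel }
      map_add' := fun φ φ' => by
        refine LinearMap.ext fun v => ?_
        simp only [LinearMap.coe_mk, AddHom.coe_mk, LinearMap.add_apply, lie_add]
        abel
      map_smul' := fun r φ => by
        refine LinearMap.ext fun v => ?_
        simp [smul_sub] }
  map_add' u v := by
    refine LinearMap.ext fun φ => LinearMap.ext fun w => ?_
    simp only [LinearMap.coe_mk, AddHom.coe_mk, LinearMap.add_apply, add_lie, map_add]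
    abel
  map_smul' r u := by
    refine LinearMap.ext fun φ => LinearMap.ext fun w => ?_
    simp [smul_sub]
  map_lie' {u v} := by
    refine LinearMap.ext fun φ => LinearMap.ext fun w => ?_
    simp only [LinearMap.coe_mk, AddHom.coe_mk, Ring.lie_def, LinearMap.sub_apply,
      Module.End.mul_apply, map_sub, lie_lie, lie_sub]
    abel

/-- The action of `Ug` on endomorphisms of the module of vector fields. -/
def actEnd : Env g →ₐ[ℂ] Module.End ℂ (Vec A →ₗ[A] Vec A) :=
  UniversalEnvelopingAlgebra.lift ℂ ((lieEnd A).comp ρ)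

theorem actEnd_ι_apply (t : g) (φ : Vec A →ₗ[A] Vec A) (v : Vec A) :
    actEnd ρ (UniversalEnvelopingAlgebra.ι ℂ t) φ v = ⁅ρ t, φ v⁆ - φ ⁅ρ t, v⁆ :=
  congrArg (fun f : Module.End ℂ (Vec A →ₗ[A] Vec A) => f φ v)
    (UniversalEnvelopingAlgebra.lift_ι_apply ℂ _ t)

/-- The diagonal action of `Ug` on `Ω¹ ⊗ Ω¹`. -/
def actForm11 : Env g →ₐ[ℂ] Module.End ℂ (Form1 A ⊗[ℂ] Form1 A) :=
  (act2 (actForm1 ρ) (actForm1 ρ)).comp (coproduct g)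

theorem actForm11_ι_tmul (t : g) (η ζ : Form1 A) :
    actForm11 ρ (UniversalEnvelopingAlgebra.ι ℂ t) (η ⊗ₜ[ℂ] ζ)
      = actForm1 ρ (UniversalEnvelopingAlgebra.ι ℂ t) η ⊗ₜ[ℂ] ζ
        + η ⊗ₜ[ℂ] actForm1 ρ (UniversalEnvelopingAlgebra.ι ℂ t) ζ := by
  have h : actForm11 ρ (UniversalEnvelopingAlgebra.ι ℂ t)
      = act2 (actForm1 ρ) (actForm1 ρ) (UniversalEnvelopingAlgebra.ι ℂ t ⊗ₜ[ℂ] 1)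
        + act2 (actForm1 ρ) (actForm1 ρ) (1 ⊗ₜ[ℂ] UniversalEnvelopingAlgebra.ι ℂ t) := by
    rw [actForm11, AlgHom.comp_apply, coproduct_ι, map_add]
  have h1 : actForm1 ρ (1 : Env g) = 1 := map_one _
  refine (congrArg (fun f => f (η ⊗ₜ[ℂ] ζ)) h).trans ?_
  change _ ⊗ₜ[ℂ] actForm1 ρ 1 ζ + actForm1 ρ 1 η ⊗ₜ[ℂ] _ = _
  rw [h1]
  rfl

variable (A)

/-- The product `h α` of a function and a 1-form. -/
def mulForm1Left : A →ₗ[ℂ] Form1 A →ₗ[ℂ] Form1 A := (mulForm1 A).flip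

/-- The interior product `i_v τ = τ(v, ·)` of a vector field and a 2-form. -/
def interior : Vec A →ₗ[ℂ] Form2 A →ₗ[ℂ] Form1 A :=
  LinearMap.mk₂ ℂ (fun v τ => τ.1 v)
    (fun v v' τ => map_add τ.1 v v')
    (fun r v τ => LinearMap.ext fun w => by
      rw [← algebraMap_smul A r v, map_smul, algebraMap_smul])
    (fun v τ τ' => rfl) (fun r v τ => rfl)

/-- The contraction `(v, η ⊗ ζ) ↦ η(v) ζ`. -/
def contraction : Vec A →ₗ[ℂ] Form1 A ⊗[ℂ] Form1 A →ₗ[ℂ] Form1 A :=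
  (TensorProduct.lift (LinearMap.mk₂ ℂ (fun η ζ => mulForm1 A ζ ∘ₗ (pairing A).flip η)
    (fun η η' ζ => by ext; simp) (fun r η ζ => by ext; simp)
    (fun η ζ ζ' => by ext; simp) (fun r η ζ => by ext; simp))).flip

/-- The endomorphism `u ↦ α(u) v` of the module of vector fields. -/
def rankOne : Form1 A →ₗ[ℂ] Vec A →ₗ[ℂ] (Vec A →ₗ[A] Vec A) :=
  LinearMap.mk₂ ℂ (fun α v => α.smulRight v)
    (fun α α' v => LinearMap.ext fun u => by simp [add_smul])
    (fun r α v => LinearMap.ext fun u => by simp)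
    (fun α v v' => LinearMap.ext fun u => by simp)
    (fun r α v => LinearMap.ext fun u => smul_comm (α u) r v)

/-- The evaluation of an endomorphism at a vector field. -/
def evalEnd : Vec A →ₗ[ℂ] (Vec A →ₗ[A] Vec A) →ₗ[ℂ] Vec A :=
  LinearMap.mk₂ ℂ (fun v φ => φ v) (fun v v' φ => map_add φ v v')
    (fun r v φ => by rw [← algebraMap_smul A r v, map_smul, algebraMap_smul])
    (fun v φ φ' => rfl) (fun r v φ => rfl)

/-- The transpose of an endomorphism of the module of vector fields, acting on 1-forms. -/
def transposeForm1 : (Vec A →ₗ[A] Vec A) →ₗ[ℂ] Form1 A →ₗ[ℂ] Form1 A :=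
  LinearMap.mk₂ ℂ (fun φ α => α ∘ₗ φ) (fun φ φ' α => LinearMap.comp_add _ _ _)
    (fun r φ α => LinearMap.ext fun v => by
      rw [LinearMap.comp_apply, LinearMap.smul_apply, ← algebraMap_smul A r (φ v), map_smul,
        algebraMap_smul]
      rfl)
    (fun φ α α' => rfl) (fun r φ α => rfl)

/-- The extension of the transpose of an endomorphism to a derivation on 2-forms,
`(φ, τ) ↦ τ(φ ·, ·) + τ(·, φ ·)`. -/
def transposeForm2 : (Vec A →ₗ[A] Vec A) →ₗ[ℂ] Form2 A →ₗ[ℂ] Form2 A :=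
  LinearMap.mk₂ ℂ
    (fun φ τ => Form2.mk (fun u v => τ.1 (φ u) v + τ.1 u (φ v))
      (by intros; simp only [map_add, LinearMap.add_apply]; ring)
      (by intros; simp only [map_smul, LinearMap.smul_apply, smul_eq_mul]; ring)
      (by intros; simp only [map_add]; ring)
      (by intros; simp only [map_smul, smul_eq_mul]; ring)
      (by intro u; rw [Form2.swap τ (φ u) u]; ring))
    (fun φ φ' τ => Form2.ext' fun u v => by simp; ring)
    (fun r φ τ => Form2.ext' fun u v => by
      simp only [Form2.mk_apply, Form2.smul_apply, LinearMap.smul_apply, smul_add]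
      rw [← algebraMap_smul A r (φ u), ← algebraMap_smul A r (φ v)]
      simp)
    (fun φ τ τ' => Form2.ext' fun u v => by simp; ring)
    (fun r φ τ => Form2.ext' fun u v => by simp)

variable {A}

theorem equivariant_pairing : Equivariant (actVec ρ) (actForm1 ρ) (actFun ρ) (pairing A) :=
  equivariant_of_lie fun t v α => by
    simp [pairing, actFun_ι, actVec_ι, actForm1_ι_apply, -UniversalEnvelopingAlgebra.ι_apply]

theorem equivariant_mulVec : Equivariant (actFun ρ) (actVec ρ) (actVec ρ) (mulVec A) :=
  equivariant_of_lie fun t h v => by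
    rw [actFun_ι, actVec_ι, actVec_ι]
    exact vec_lie_smul (ρ t) v h

theorem equivariant_mulForm1 :
    Equivariant (actForm1 ρ) (actFun ρ) (actForm1 ρ) (mulForm1 A) :=
  equivariant_of_lie fun t α h => LinearMap.ext fun v => by
    have e : ∀ (α : Form1 A) (h : A) (v : Vec A), mulForm1 A α h v = h * α v := fun _ _ _ => rfl
    rw [LinearMap.add_apply, actFun_ι, actForm1_ι_apply, e, e, e, e, actForm1_ι_apply,
      Derivation.leibniz]
    simp only [smul_eq_mul]
    ring

theorem equivariant_mulForm1Left :
    Equivariant (actFun ρ) (actForm1 ρ) (actForm1 ρ) (mulForm1Left A) :=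
  equivariant_of_lie fun t h α => LinearMap.ext fun v => by
    have e : ∀ (α : Form1 A) (h : A) (v : Vec A), mulForm1Left A h α v = h * α v :=
      fun _ _ _ => rfl
    rw [LinearMap.add_apply, actFun_ι, actForm1_ι_apply, e, e, e, e, actForm1_ι_apply,
      Derivation.leibniz]
    simp only [smul_eq_mul]
    ring

theorem equivariant_lieVec :
    Equivariant (actVec ρ) (actVec ρ) (actVec ρ) (lieVec A : Vec A →ₗ[ℂ] Vec A →ₗ[ℂ] Vec A) :=
  equivariant_of_lie fun t u v => by
    rw [actVec_ι, actVec_ι, actVec_ι]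
    exact leibniz_lie (ρ t) u v

theorem wedge11_apply (α β : Form1 A) (u v : Vec A) :
    (wedge11 A α β).1 u v = α u * β v - α v * β u := rfl

theorem wedge12_val (α : Form1 A) (τ : Form2 A) (u v w : Vec A) :
    (wedge12 A α τ).val u v w = α u * τ.1 v w - α v * τ.1 u w + α w * τ.1 u v := rfl

theorem wedge21_val (τ : Form2 A) (α : Form1 A) (u v w : Vec A) :
    (wedge21 A τ α).val u v w = τ.1 u v * α w - τ.1 u w * α v + τ.1 v w * α u := rfl

theorem d1_apply (α : Form1 A) (u v : Vec A) :
    (d1 A α).1 u v = u (α v) - v (α u) - α ⁅u, v⁆ := rfl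

theorem d2_val (τ : Form2 A) (u v w : Vec A) :
    (d2 A τ).val u v w = u (τ.1 v w) - v (τ.1 u w) + w (τ.1 u v)
      - τ.1 ⁅u, v⁆ w + τ.1 ⁅u, w⁆ v - τ.1 ⁅v, w⁆ u := rfl

theorem interior_apply (v : Vec A) (τ : Form2 A) (w : Vec A) : interior A v τ w = τ.1 v w := rfl

theorem contraction_tmul (v : Vec A) (η ζ : Form1 A) :
    contraction A v (η ⊗ₜ[ℂ] ζ) = η v • ζ := rfl

theorem rankOne_apply (α : Form1 A) (v u : Vec A) : rankOne A α v u = α u • v := rfl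

theorem transposeForm1_apply (φ : Vec A →ₗ[A] Vec A) (α : Form1 A) (v : Vec A) :
    transposeForm1 A φ α v = α (φ v) := rfl

theorem transposeForm2_apply (φ : Vec A →ₗ[A] Vec A) (τ : Form2 A) (u v : Vec A) :
    (transposeForm2 A φ τ).1 u v = τ.1 (φ u) v + τ.1 u (φ v) := rfl

theorem equivariant_wedge11 :
    Equivariant (actForm1 ρ) (actForm1 ρ) (actForm2 ρ) (wedge11 A) :=
  equivariant_of_lie fun t α β => Form2.ext' fun u v => by
    simp only [Form2.add_apply, actForm2_ι_apply, wedge11_apply, actForm1_ι_apply, map_sub,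
      Derivation.leibniz, smul_eq_mul]
    ring

theorem equivariant_interior :
    Equivariant (actVec ρ) (actForm2 ρ) (actForm1 ρ) (interior A) :=
  equivariant_of_lie fun t v τ => LinearMap.ext fun w => by
    simp only [LinearMap.add_apply, actForm1_ι_apply, interior_apply, actVec_ι, actForm2_ι_apply]
    ring

theorem equivariant_contraction :
    Equivariant (Y := Form1 A ⊗[ℂ] Form1 A) (actVec ρ) (actForm11 ρ) (actForm1 ρ)
      (contraction A) :=
  equivariant_of_lie fun t v s => by
    induction s using TensorProduct.induction_on with
    | zero => simp
    | add s s' hs hs' => simp only [map_add, hs, hs']; abel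
    | tmul η ζ =>
      refine LinearMap.ext fun w => ?_
      rw [actForm11_ι_tmul, map_add]
      simp only [contraction_tmul, LinearMap.add_apply, actForm1_ι_apply, LinearMap.smul_apply,
        actVec_ι, smul_eq_mul, Derivation.leibniz]
      ring

theorem equivariant_tmul :
    Equivariant (Z := Form1 A ⊗[ℂ] Form1 A) (actForm1 ρ) (actForm1 ρ) (actForm11 ρ)
      (TensorProduct.mk ℂ (Form1 A) (Form1 A)) := by
  intro ξ s
  have h : TensorProduct.lift (TensorProduct.mk ℂ (Form1 A) (Form1 A)) = LinearMap.id :=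
    TensorProduct.ext' fun _ _ => rfl
  rw [h]
  rfl

theorem equivariant_rankOne :
    Equivariant (actForm1 ρ) (actVec ρ) (actEnd ρ) (rankOne A) :=
  equivariant_of_lie fun t α v => LinearMap.ext fun u => by
    simp only [LinearMap.add_apply, actEnd_ι_apply, rankOne_apply, actForm1_ι_apply, actVec_ι,
      vec_lie_smul, sub_smul]
    abel

/-- The exterior derivative commutes with Lie derivatives. -/
theorem intertwines_d1 : Intertwines (actForm1 ρ) (actForm2 ρ) (d1 A) :=
  intertwines_of_lie fun t α => Form2.ext' fun u v => by
    simp only [d1_apply, actForm1_ι_apply, actForm2_ι_apply, map_sub, Derivation.commutator_apply,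
      leibniz_lie (ρ t) u v, map_add]
    ring

theorem invariant_one : Invariant (actFun ρ) (1 : A) :=
  invariant_of_lie fun t => by rw [actFun_ι, Derivation.map_one_eq_zero]

theorem invariant_id : Invariant (actEnd ρ) (LinearMap.id : Vec A →ₗ[A] Vec A) :=
  invariant_of_lie fun t => LinearMap.ext fun v => by
    rw [actEnd_ι_apply, LinearMap.id_apply, LinearMap.id_apply, sub_self, LinearMap.zero_apply]

theorem d2_wedge11 (α β : Form1 A) :
    d2 A (wedge11 A α β) = wedge21 A (d1 A α) β - wedge12 A α (d1 A β) :=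
  Form3.ext' fun u v w => by
    simp only [Form3.sub_apply, d2_val, wedge11_apply, wedge21_val, wedge12_val, d1_apply,
      map_sub, Derivation.leibniz, smul_eq_mul]
    ring

theorem d2_d1 (α : Form1 A) : d2 A (d1 A α) = 0 :=
  Form3.ext' fun u v w => by
    have h0 : (0 : Form3 A).val u v w = 0 := rfl
    have hJ := congrArg α (leibniz_lie u v w)
    simp only [h0, d2_val, d1_apply, map_sub, Derivation.commutator_apply, map_add] at hJ ⊢
    have e2 : α ⁅⁅u, w⁆, v⁆ = - α ⁅v, ⁅u, w⁆⁆ := by rw [← lie_skew, map_neg]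
    have e3 : α ⁅⁅v, w⁆, u⁆ = - α ⁅u, ⁅v, w⁆⁆ := by rw [← lie_skew, map_neg]
    rw [e2, e3, hJ]
    ring

theorem wedge21_wedge11 (α β γ : Form1 A) :
    wedge21 A (wedge11 A α β) γ = wedge12 A α (wedge11 A β γ) :=
  Form3.ext' fun u v w => by
    simp only [wedge21_val, wedge12_val, wedge11_apply]
    ring

end CartanEquivariance

/-! ### The resolution of the identity of a ⋆-dual pair of frames -/

section StarFrames

variable {A : Type*} [CommRing A] [Algebra ℂ A] {g : Type*} [LieRing g] [LieAlgebra ℂ g]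
  (T : Twist g) (ρ : g →ₗ⁅ℂ⁆ Vec A)

/-- The ⋆-product of functions. -/
def starMul : Formal A →ₗ[ℂ] Formal A →ₗ[ℂ] Formal A :=
  starOf T (actFun ρ) (actFun ρ) (mulFun A)

/-- `h ⋆ α` for a function `h` and a 1-form `α`. -/
def starForm1Left : Formal A →ₗ[ℂ] Formal (Form1 A) →ₗ[ℂ] Formal (Form1 A) :=
  starOf T (actFun ρ) (actForm1 ρ) (mulForm1Left A)

/-- The ⋆-interior product of a vector field and a 2-form. -/
def starInterior : Formal (Vec A) →ₗ[ℂ] Formal (Form2 A) →ₗ[ℂ] Formal (Form1 A) :=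
  starOf T (actVec ρ) (actForm2 ρ) (interior A)

theorem shiftLinear_starPairing (α : Formal (Form1 A)) :
    ShiftLinear ((starPairing T ρ).flip α) :=
  shiftLinear_starOf_left T _ α

theorem starPairing_starVec (h : Formal A) (v : Formal (Vec A)) (α : Formal (Form1 A)) :
    starPairing T ρ (starVec T ρ h v) α = starMul T ρ h (starPairing T ρ v α) :=
  starOf_assoc T (equivariant_mulVec ρ) (equivariant_pairing ρ)
    (fun h v α => map_smul α h v) h v α

theorem starPairing_starForm1 (u : Formal (Vec A)) (α : Formal (Form1 A)) (h : Formal A) :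
    starPairing T ρ u (starForm1 T ρ α h) = starMul T ρ (starPairing T ρ u α) h :=
  (starOf_assoc T (equivariant_pairing ρ) (equivariant_mulForm1 ρ)
    (fun u α h => mul_comm (α u) h) u α h).symm

theorem starForm2_starWedge11 (α β : Formal (Form1 A)) (h : Formal A) :
    starForm2 T ρ (starWedge11 T ρ α β) h = starWedge11 T ρ α (starForm1 T ρ β h) :=
  starOf_assoc T (equivariant_wedge11 ρ) (equivariant_mulForm1 ρ)
    (fun α β h => Form2.ext' fun u v => by
      change h * (α u * β v - α v * β u) = α u * (h * β v) - α v * (h * β u)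
      ring) α β h

theorem one_starVec (v : Formal (Vec A)) : starVec T ρ (Pi.single 0 1) v = v := by
  rw [starVec, starOf_invariant_left T _ (invariant_one ρ)]
  exact funext fun n => one_smul A (v n)

theorem starMul_one (h : Formal A) : starMul T ρ h (Pi.single 0 1) = h := by
  rw [starMul, starOf_invariant_right T _ (invariant_one ρ)]
  exact funext fun n => mul_one (h n)

variable {T ρ}
variable {ι : Type*} [Fintype ι] [DecidableEq ι] (E : StarFrame T ρ ι)

/-- The ⋆-dual frames resolve the identity: `∑ θʲ ⊗_⋆ eⱼ`, as an endomorphism of the module of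
vector fields, is the identity. Duality makes it act as the identity on the frame; as the
`λ⁰`-parts of the frame span, no lowest-order term of the difference can survive. -/
theorem StarFrame.sum_rankOne :
    ∑ j, starOf T (actForm1 ρ) (actVec ρ) (rankOne A) (E.θ j) (E.e j)
      = (Pi.single 0 (LinearMap.id : Vec A →ₗ[A] Vec A) : Formal (Vec A →ₗ[A] Vec A)) := by
  set S := ∑ j, starOf T (actForm1 ρ) (actVec ρ) (rankOne A) (E.θ j) (E.e j) with hS
  have h : ∀ i, starOf T (actVec ρ) (actEnd ρ) (evalEnd A) (E.e i)
      (S - (Pi.single 0 LinearMap.id : Formal (Vec A →ₗ[A] Vec A))) = 0 := by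
    intro i
    rw [map_sub, starOf_invariant_right T _ (invariant_id ρ), hS, map_sum, sub_eq_zero]
    refine (Finset.sum_congr rfl fun j _ => ?_ : _ = ∑ j, if i = j then E.e i else 0).trans ?_
    · rw [← starOf_assoc T (μ := mulVec A) (equivariant_pairing ρ) (equivariant_rankOne ρ)
        (fun _ _ _ => rfl)]
      change starVec T ρ (starPairing T ρ (E.e i) (E.θ j)) (E.e j) = _
      rw [E.dual]
      split_ifs with hij
      · rw [one_starVec, hij]
      · rw [map_zero, LinearMap.zero_apply]
    · rw [Finset.sum_ite_eq, if_pos (Finset.mem_univ i)]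
      rfl
  rw [← sub_eq_zero]
  funext n
  induction n using Nat.strong_induction_on with
  | _ n ih =>
    refine LinearMap.ext_on E.span_eq_top ?_
    rintro _ ⟨i, rfl⟩
    have h' := congrFun (h i) n
    rw [starOf_apply_of_lt T _ _ _ n ih] at h'
    exact h'

theorem StarFrame.sum_starVec (v : Formal (Vec A)) :
    ∑ j, starVec T ρ (starPairing T ρ v (E.θ j)) (E.e j) = v := by
  have h := congrArg (starOf T (actVec ρ) (actEnd ρ) (evalEnd A) v) E.sum_rankOne
  rw [starOf_invariant_right T _ (invariant_id ρ), map_sum] at h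
  refine Eq.trans (Finset.sum_congr rfl fun j _ => ?_) h
  exact starOf_assoc T (equivariant_pairing ρ) (equivariant_rankOne ρ) (fun _ _ _ => rfl) _ _ _

theorem StarFrame.sum_starForm1 (α : Formal (Form1 A)) :
    ∑ j, starForm1 T ρ (E.θ j) (starPairing T ρ (E.e j) α) = α := by
  have h := congrArg (fun S => starOf T (actEnd ρ) (actForm1 ρ) (transposeForm1 A) S α)
    E.sum_rankOne
  simp only [starOf_invariant_left T _ (invariant_id ρ), map_sum, LinearMap.sum_apply] at h
  refine Eq.trans (Finset.sum_congr rfl fun j _ => ?_) h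
  refine (starOf_assoc T (equivariant_rankOne ρ) (equivariant_pairing ρ)
    (fun θ e α => LinearMap.ext fun v => ?_) _ _ _).symm
  rw [transposeForm1_apply, rankOne_apply, map_smul]
  exact mul_comm (θ v) (α e)

/-- A 2-form is half the sum of the `θʲ ∧_⋆ i_{eⱼ} τ`: the identity endomorphism extends to
2-forms as the derivation which multiplies by 2. -/
theorem StarFrame.sum_starWedge11_starInterior (τ : Formal (Form2 A)) :
    ∑ j, starWedge11 T ρ (E.θ j) (starInterior T ρ (E.e j) τ) = (2 : ℂ) • τ := by
  have h := congrArg (fun S => starOf T (actEnd ρ) (actForm2 ρ) (transposeForm2 A) S τ)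
    E.sum_rankOne
  simp only [starOf_invariant_left T _ (invariant_id ρ), map_sum, LinearMap.sum_apply] at h
  have h2 : formalMap (transposeForm2 A LinearMap.id) τ = (2 : ℂ) • τ := by
    funext n
    refine Form2.ext' fun u v => ?_
    change _ = (2 : ℂ) • (τ n).1 u v
    rw [two_smul]
    rfl
  rw [h2] at h
  refine Eq.trans (Finset.sum_congr rfl fun j _ => ?_) h
  refine (starOf_assoc T (equivariant_rankOne ρ) (equivariant_interior ρ)
    (fun θ e τ => Form2.ext' fun u v => ?_) _ _ _).symm
  rw [transposeForm2_apply, rankOne_apply, rankOne_apply, wedge11_apply, interior_apply,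
    interior_apply, map_smul, map_smul, Form2.swap τ u e]
  simp only [LinearMap.smul_apply, smul_eq_mul]
  ring

/-- The expansion of a 2-form in a frame. -/
theorem StarFrame.expand_form2 (τ : Formal (Form2 A)) :
    (1 / 2 : ℂ) • ∑ i, ∑ j, starForm2 T ρ (starWedge11 T ρ (E.θ j) (E.θ i))
      (starPairing T ρ (E.e i) (starInterior T ρ (E.e j) τ)) = τ := by
  rw [Finset.sum_comm]
  simp only [starForm2_starWedge11, ← map_sum, E.sum_starForm1]
  rw [E.sum_starWedge11_starInterior, smul_smul]
  norm_num

end StarFrames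

/-! ### The deformed Cartan formula -/

section StarCartan

variable {A : Type*} [CommRing A] [Algebra ℂ A] {g : Type*} [LieRing g] [LieAlgebra ℂ g]
  (T : Twist g) (ρ : g →ₗ⁅ℂ⁆ Vec A)

/-- The bilinear map `(u, v) ↦ ℒ^⋆_u ⟨v, η⟩_⋆`. -/
def lieOfPairing (η : Formal (Form1 A)) :
    Formal (Vec A) →ₗ[ℂ] Formal (Vec A) →ₗ[ℂ] Formal A :=
  (starLieFun T ρ).compl₂ ((starPairing T ρ).flip η)

/-- The bilinear map `(u, v) ↦ ⟨u, ⟨v, η⟩_⋆ ⋆ ζ⟩_⋆`. -/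
def nestedPairing (η ζ : Formal (Form1 A)) :
    Formal (Vec A) →ₗ[ℂ] Formal (Vec A) →ₗ[ℂ] Formal A :=
  (starPairing T ρ).compl₂ ((starForm1Left T ρ).flip ζ ∘ₗ (starPairing T ρ).flip η)

/-- The deformation of `dη(u, v) = u(η(v)) - v(η(u)) - η([u, v])`, where the exchange of `u` and
`v` becomes that by `ℛ⁻¹`. -/
theorem starCartan (η : Formal (Form1 A)) (u v : Formal (Vec A)) :
    lieOfPairing T ρ η u v
        - twistBy (T.R⁻¹).val (actVec ρ) (actVec ρ) (lieOfPairing T ρ η) v u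
        - starPairing T ρ (starLie T ρ u v) η
      = -starPairing T ρ u (starInterior T ρ v (formalMap (d1 A) η)) := by
  have h1 : ∀ u v, lieOfPairing T ρ η u v = triStar T (actVec ρ) (actVec ρ) (actForm1 ρ) _ u v η :=
    fun u v => starOf_starOf_right T (equivariant_pairing ρ) _ u v η
  have h2 : starInterior T ρ v (formalMap (d1 A) η) = starOf T _ _ _ v η :=
    starOf_formalMap_right T _ (intertwines_d1 ρ) v η
  rw [twistBy_R_inv T _ η h1, h1, h2, starPairing, starLie,
    starOf_starOf_right T ((equivariant_interior ρ).compl₂ (intertwines_d1 ρ)), starOf_starOf_left T (equivariant_lieVec ρ),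
    sub_sub, sub_eq_iff_eq_add, ← sub_eq_neg_add, eq_sub_iff_add_eq, ← triStar_add, ← triStar_add]
  congr 1
  refine TensorProduct.ext_threefold fun u v α => ?_
  change u (α v) + (d1 A α).1 v u = v (α u) + α ⁅u, v⁆
  rw [d1_apply, ← lie_skew, map_neg]
  ring

/-- The deformation of `(η ∧ ζ)(v, u) = η(v) ζ(u) - η(u) ζ(v)`, where the exchange of `u` and `v`
becomes that by `ℛ⁻¹`. -/
theorem nestedPairing_sub_swap (η ζ : Formal (Form1 A)) (u v : Formal (Vec A)) :
    nestedPairing T ρ η ζ u v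
        - twistBy (T.R⁻¹).val (actVec ρ) (actVec ρ) (nestedPairing T ρ η ζ) v u
      = starPairing T ρ u (starInterior T ρ v (starWedge11 T ρ η ζ)) := by
  -- `t = η ⊗_⋆ ζ`, in terms of which all maps are trilinear in `u`, `v`, `t`.
  let t : Formal (Form1 A ⊗[ℂ] Form1 A) :=
    starOf T (actForm1 ρ) (actForm1 ρ) (TensorProduct.mk ℂ (Form1 A) (Form1 A)) η ζ
  have h0 : ∀ v, starForm1Left T ρ (starPairing T ρ v η) ζ
      = starOf T (actVec ρ) (actForm11 ρ) (contraction A) v t := fun v =>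
    starOf_assoc T (equivariant_pairing ρ) (equivariant_tmul ρ) (fun _ _ _ => rfl) v η ζ
  have h1 : ∀ u v, nestedPairing T ρ η ζ u v
      = triStar T (actVec ρ) (actVec ρ) (actForm11 ρ) _ u v t := fun u v =>
    (congrArg (starPairing T ρ u) (h0 v)).trans
      (starOf_starOf_right T (equivariant_contraction ρ) _ u v t)
  have h2 : starWedge11 T ρ η ζ = formalMap (TensorProduct.lift (wedge11 A)) t := by
    rw [formalMap_starOf]
    rfl
  have h3 : starInterior T ρ v (starWedge11 T ρ η ζ) = starOf T (actVec ρ) (actForm11 ρ)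
      ((interior A).compl₂ (TensorProduct.lift (wedge11 A))) v t := by
    rw [h2]
    exact starOf_formalMap_right T _ (equivariant_wedge11 ρ) v t
  have hw : Intertwines (X := Form1 A ⊗[ℂ] Form1 A) (actForm11 ρ) (actForm2 ρ)
      (TensorProduct.lift (wedge11 A)) :=
    equivariant_wedge11 ρ
  rw [twistBy_R_inv T _ t h1, h1, h3, starPairing,
    starOf_starOf_right T ((equivariant_interior ρ).compl₂ hw),
    sub_eq_iff_eq_add, ← triStar_add]
  congr 1
  refine TensorProduct.ext_threefold fun u v s => ?_
  induction s using TensorProduct.induction_on with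
  | zero => simp
  | add s s' hs hs' => simp only [TensorProduct.tmul_add, map_add, hs, hs']
  | tmul α β =>
    change α v * β u = (α v * β u - α u * β v) + α u * β v
    ring

end StarCartan

/-! ### The Cartan structure equations -/

section Structure

variable {A : Type*} [CommRing A] [Algebra ℂ A] {g : Type*} [LieRing g] [LieAlgebra ℂ g]
  {T : Twist g} {ρ : g →ₗ⁅ℂ⁆ Vec A} {ι : Type*} [Fintype ι] [DecidableEq ι]
  (D : StarConnection T ρ) (E : StarFrame T ρ ι)

/-- The connection forms represent the covariant derivatives of the frame:
`∇^⋆_u eₖ = ⟨u, ωₖˡ⟩_⋆ ⋆ eₗ` for every vector field `u`. -/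
theorem starPairing_nabla_frame (u : Formal (Vec A)) (k l : ι) :
    starPairing T ρ (D.nabla u (E.e k)) (E.θ l)
      = starPairing T ρ u (connectionForm D E k l) := by
  conv_lhs => rw [← E.sum_starVec u]
  simp only [connectionForm, map_sum, LinearMap.sum_apply, D.nabla_star_left, starPairing_starVec,
    starPairing_starForm1]
  rfl

/-- The Leibniz rule in a frame. The term of `∇^⋆_u (h ⋆ eₘ)` which carries the `ℛ`-matrix becomes
`⟨u, h ⋆ ωₘˡ⟩_⋆`, with `u` in first position. -/
theorem starPairing_nabla_starVec (u : Formal (Vec A)) (h : Formal A) (m l : ι) :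
    starPairing T ρ (D.nabla u (starVec T ρ h (E.e m))) (E.θ l)
      = (if m = l then starLieFun T ρ u h else 0)
        + starPairing T ρ u (starForm1Left T ρ h (connectionForm D E m l)) := by
  rw [D.nabla_star_right, map_add, LinearMap.add_apply, starPairing_starVec, E.dual]
  congr 1
  · split_ifs
    · exact starMul_one T ρ _
    · exact map_zero _
  · have hm := map_twistBy (shiftLinear_starPairing T ρ (E.θ l)) (a := actFun ρ)
      (b := actVec ρ) (T.R⁻¹).val ((starVec T ρ).compl₂ (D.nabla.flip (E.e m))) h u
    refine hm.trans ?_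
    have hB : ∀ h u, (((starVec T ρ).compl₂ (D.nabla.flip (E.e m))).compr₂
        ((starPairing T ρ).flip (E.θ l))) h u
          = triStar T (actFun ρ) (actVec ρ) (actForm1 ρ) (TensorProduct.lift (mulFun A) ∘ₗ
            (TensorProduct.lift (pairing A)).lTensor A ∘ₗ
              (TensorProduct.assoc ℂ A (Vec A) (Form1 A)).toLinearMap)
              h u (connectionForm D E m l) := by
      intro h u
      change starPairing T ρ (starVec T ρ h (D.nabla u (E.e m))) (E.θ l) = _
      rw [starPairing_starVec, starPairing_nabla_frame]
      exact starOf_starOf_right T (equivariant_pairing ρ) _ _ _ _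
    rw [twistBy_R_inv T _ _ hB, starPairing, starForm1Left,
      starOf_starOf_right T (equivariant_mulForm1Left ρ)]
    congr 1
    exact TensorProduct.ext_threefold fun u h α => rfl

/-- For forms `ηᵐ`, the `ℛ`-antisymmetrization of the second-order expression
`∇^⋆_u (⟨v, ηᵐ⟩_⋆ ⋆ eₘ)` is given by the forms `dηˡ - ηᵐ ∧_⋆ ωₘˡ`. Both the torsion (`η = θ`)
and the curvature (`η = ωₖ`) are of this shape. -/
theorem starPairing_antisymm_nabla (η : ι → Formal (Form1 A))
    (N : Formal (Vec A) →ₗ[ℂ] Formal (Vec A) →ₗ[ℂ] Formal (Vec A))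
    (hN : ∀ u v, N u v = D.nabla u (∑ m, starVec T ρ (starPairing T ρ v (η m)) (E.e m)))
    (u v : Formal (Vec A)) (l : ι) :
    starPairing T ρ (N u v - twistBy (T.R⁻¹).val (actVec ρ) (actVec ρ) N v u) (E.θ l)
        - starPairing T ρ (starLie T ρ u v) (η l)
      = -starPairing T ρ u (starInterior T ρ v
          (formalMap (d1 A) (η l) - ∑ m, starWedge11 T ρ (η m) (connectionForm D E m l))) := by
  have hB : N.compr₂ ((starPairing T ρ).flip (E.θ l))
      = lieOfPairing T ρ (η l) + ∑ m, nestedPairing T ρ (η m) (connectionForm D E m l) := by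
    refine LinearMap.ext₂ fun u v => ?_
    change starPairing T ρ (N u v) (E.θ l) = _
    simp only [hN, map_sum, LinearMap.sum_apply, LinearMap.add_apply, starPairing_nabla_starVec,
      Finset.sum_add_distrib, Finset.sum_ite_eq', Finset.mem_univ, if_true]
    rfl
  have h1 : starPairing T ρ (N u v) (E.θ l) = _ := LinearMap.congr_fun₂ hB u v
  have h2 : starPairing T ρ (twistBy (T.R⁻¹).val (actVec ρ) (actVec ρ) N v u) (E.θ l) = _ :=
    map_twistBy (shiftLinear_starPairing T ρ (E.θ l)) (T.R⁻¹).val N v u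
  rw [map_sub, LinearMap.sub_apply, h1, h2, hB, twistBy_add, twistBy_sum, map_sub, map_sub,
    neg_sub, map_sum, map_sum]
  simp only [LinearMap.add_apply, LinearMap.sum_apply, ← nestedPairing_sub_swap,
    Finset.sum_sub_distrib]
  rw [← sub_eq_zero, ← sub_eq_zero.2 (starCartan T ρ (η l) u v)]
  abel

/-- The first Cartan structure equation, `Θˡ = dθˡ - θᵐ ∧_⋆ ωₘˡ`. -/
theorem torsionForm_eq (l : ι) :
    torsionForm D E l = formalMap (d1 A) (E.θ l)
      - ∑ m, starWedge11 T ρ (E.θ m) (connectionForm D E m l) := by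
  rw [← E.expand_form2 (formalMap (d1 A) (E.θ l)
    - ∑ m, starWedge11 T ρ (E.θ m) (connectionForm D E m l)), torsionForm, ← smul_neg,
    ← Finset.sum_neg_distrib]
  congr 1
  refine Finset.sum_congr rfl fun i _ => ?_
  rw [← Finset.sum_neg_distrib]
  refine Finset.sum_congr rfl fun j _ => ?_
  rw [← map_neg]
  congr 1
  have h := starPairing_antisymm_nabla D E E.θ D.nabla
    (fun u v => by rw [E.sum_starVec]) (E.e i) (E.e j) l
  rw [torsionCoeff, StarConnection.torsion, map_sub, LinearMap.sub_apply, h, neg_neg]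

/-- The second Cartan structure equation, `Ωₖˡ = dωₖˡ - ωₖᵐ ∧_⋆ ωₘˡ`. -/
theorem curvatureForm_eq (k l : ι) :
    curvatureForm D E k l = formalMap (d1 A) (connectionForm D E k l)
      - ∑ m, starWedge11 T ρ (connectionForm D E k m) (connectionForm D E m l) := by
  rw [← E.expand_form2 (formalMap (d1 A) (connectionForm D E k l)
    - ∑ m, starWedge11 T ρ (connectionForm D E k m) (connectionForm D E m l)), curvatureForm,
    ← smul_neg, ← Finset.sum_neg_distrib]
  congr 1
  refine Finset.sum_congr rfl fun i _ => ?_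
  rw [← Finset.sum_neg_distrib]
  refine Finset.sum_congr rfl fun j _ => ?_
  rw [← map_neg]
  congr 1
  have h := starPairing_antisymm_nabla D E (connectionForm D E k) (D.nabla₂ (E.e k))
    (fun u v => by
      simp only [← starPairing_nabla_frame]
      rw [E.sum_starVec]
      rfl) (E.e i) (E.e j) l
  rw [curvatureCoeff, StarConnection.curvature, map_sub, LinearMap.sub_apply,
    starPairing_nabla_frame, h, neg_neg]

end Structure

/-! ### The Bianchi identities -/

section Bianchi

variable {A : Type*} [CommRing A] [Algebra ℂ A] {g : Type*} [LieRing g] [LieAlgebra ℂ g]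
  {T : Twist g} {ρ : g →ₗ⁅ℂ⁆ Vec A}

/-- The graded Leibniz rule for the undeformed exterior derivative and the ⋆-wedge product. -/
theorem d2_starWedge11 (α β : Formal (Form1 A)) :
    formalMap (d2 A) (starWedge11 T ρ α β)
      = starWedge21 T ρ (formalMap (d1 A) α) β - starWedge12 T ρ α (formalMap (d1 A) β) := by
  have h : (wedge11 A).compr₂ (d2 A) + (wedge12 A).compl₂ (d1 A) = (wedge21 A).comp (d1 A) :=
    LinearMap.ext₂ fun α β => by
      change d2 A (wedge11 A α β) + wedge12 A α (d1 A β) = wedge21 A (d1 A α) β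
      rw [d2_wedge11, sub_add_cancel]
  rw [starWedge11, formalMap_starOf, starWedge21, starWedge12,
    starOf_formalMap_left T _ (intertwines_d1 ρ), starOf_formalMap_right T _ (intertwines_d1 ρ),
    ← h, starOf_add, add_sub_cancel_right]

theorem starWedge21_starWedge11 (α β γ : Formal (Form1 A)) :
    starWedge21 T ρ (starWedge11 T ρ α β) γ = starWedge12 T ρ α (starWedge11 T ρ β γ) :=
  starOf_assoc T (equivariant_wedge11 ρ) (equivariant_wedge11 ρ) wedge21_wedge11 α β γ

theorem formalMap_d2_d1 (α : Formal (Form1 A)) : formalMap (d2 A) (formalMap (d1 A) α) = 0 :=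
  funext fun n => d2_d1 (α n)

/-- The covariant exterior derivative squares to multiplication by the curvature: for a row of
1-forms `ηʲ`, the covariant derivative of `dηˡ - ηʲ ∧_⋆ ωⱼˡ` is `ηʲ ∧_⋆ (dωⱼˡ - ωⱼᵐ ∧_⋆ ωₘˡ)`. -/
theorem covariant_d2 {ι : Type*} [Fintype ι] (η : ι → Formal (Form1 A))
    (Γ : ι → ι → Formal (Form1 A)) (l : ι) :
    formalMap (d2 A) (formalMap (d1 A) (η l) - ∑ j, starWedge11 T ρ (η j) (Γ j l))
        + ∑ j, starWedge21 T ρ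
          (formalMap (d1 A) (η j) - ∑ k, starWedge11 T ρ (η k) (Γ k j)) (Γ j l)
      = ∑ j, starWedge12 T ρ (η j)
          (formalMap (d1 A) (Γ j l) - ∑ m, starWedge11 T ρ (Γ j m) (Γ m l)) := by
  simp only [map_sub, map_sum, LinearMap.sub_apply, LinearMap.sum_apply, formalMap_d2_d1,
    d2_starWedge11, starWedge21_starWedge11, Finset.sum_sub_distrib]
  rw [Finset.sum_comm (f := fun j k => starWedge12 T ρ (η k) (starWedge11 T ρ (Γ k j) (Γ j l)))]
  abel

end Bianchi

end StarGeometry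

end

theorem mainTheorem2
    {E : Type*} [NormedAddCommGroup E] [NormedSpace ℝ E] [FiniteDimensional ℝ E]
    {M : Type*} [TopologicalSpace M] [T2Space M] [SigmaCompactSpace M] [ChartedSpace E M]
    [IsManifold 𝓘(ℝ, E) ∞ M] (U : TopologicalSpace.Opens M)
    {g : Type*} [LieRing g] [LieAlgebra ℂ g] (T : StarGeometry.Twist g)
    (ρ : g →ₗ⁅ℂ⁆ StarGeometry.Vec (StarGeometry.SmoothFun E U))
    (D : StarGeometry.StarConnection T ρ)
    {ι : Type*} [Fintype ι] [DecidableEq ι] (e : StarGeometry.StarFrame T ρ ι) :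
    (∀ i : ι,
      StarGeometry.formalMap (StarGeometry.d2 (StarGeometry.SmoothFun E U))
          (StarGeometry.torsionForm D e i)
        + ∑ j, StarGeometry.starWedge21 T ρ (StarGeometry.torsionForm D e j)
            (StarGeometry.connectionForm D e j i)
      = ∑ j, StarGeometry.starWedge12 T ρ (e.θ j) (StarGeometry.curvatureForm D e j i)) ∧
    (∀ k l : ι,
      StarGeometry.formalMap (StarGeometry.d2 (StarGeometry.SmoothFun E U))
          (StarGeometry.curvatureForm D e k l)
        + ∑ m, StarGeometry.starWedge21 T ρ (StarGeometry.curvatureForm D e k m)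
            (StarGeometry.connectionForm D e m l)
        - ∑ m, StarGeometry.starWedge12 T ρ (StarGeometry.connectionForm D e k m)
            (StarGeometry.curvatureForm D e m l) = 0) := by
  refine ⟨fun i => ?_, fun k l => ?_⟩
  · simp only [StarGeometry.torsionForm_eq, StarGeometry.curvatureForm_eq]
    exact StarGeometry.covariant_d2 e.θ _ i
  · simp only [StarGeometry.curvatureForm_eq]
    exact sub_eq_zero.2 (StarGeometry.covariant_d2 (StarGeometry.connectionForm D e k) _ l)
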